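/- Let $\Gamma=\langle x,y \mid y^{-1}x^2y=x^{-2},\ x^{-1}y^2x=y^{-2}\rangle$ be the (Passman) fours group and let $N=\langle x^2,y^2\rangle\le\Gamma$. Then $N$ is a normal subgroup of $\Gamma$, and $\Gamma/N$ is infinite dihedral, generated by the two involutions $Nx$ and $Ny$. Let $W$ be the set of all alternating words in $x$ and $y$ (words, including the empty word, in which no two neighbouring letters are equal). Every $g\in\Gamma$ lies in $Nw$ for exactly one $w\in W$, and the length $L(g)$ is defined to be the number of letters of this $w$. For a field $K$ and $0\neq\sigma\in K\Gamma$ let $L(\sigma)$ be the maximum of $L(g)$ over all $g$ in the support of $\sigma$, and let $L(0)=-\infty$. A unit of $K\Gamma$ (that is, a two-sided unit) is called trivial if it is of the form $\lambda g$ with $\lambda\in K\setminus\{0\}$ and $g\in\Gamma$. Theorem. For every field $K$, every unit $\sigma$ of $K\Gamma$ with $L(\sigma)=3$ is trivial; more generally, every unit $\sigma$ of $K\Gamma$ with $L(\sigma)\le 3$ is trivial. -/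

import Mathlib

namespace FoursGroup

/-- The two letters used for the generators of the fours group. -/
inductive Letter : Type
  | x
  | y

/-- The relators `(y⁻¹ x² y) (x⁻²)⁻¹` and `(x⁻¹ y² x) (y⁻²)⁻¹`. -/
def relators : Set (FreeGroup Letter) :=
  {(FreeGroup.of Letter.y)⁻¹ * FreeGroup.of Letter.x ^ 2 * FreeGroup.of Letter.y *
      ((FreeGroup.of Letter.x ^ 2)⁻¹)⁻¹,
    (FreeGroup.of Letter.x)⁻¹ * FreeGroup.of Letter.y ^ 2 * FreeGroup.of Letter.x *
      ((FreeGroup.of Letter.y ^ 2)⁻¹)⁻¹}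

/-- The (Passman) fours group `Γ = ⟨x, y ∣ y⁻¹x²y = x⁻², x⁻¹y²x = y⁻²⟩`. -/
abbrev Gam : Type := PresentedGroup relators

/-- The generator of `Γ` named by a letter. -/
def gen (l : Letter) : Gam := PresentedGroup.of l

/-- The subgroup `N = ⟨x², y²⟩` of `Γ`. -/
def N : Subgroup Gam := Subgroup.closure {gen Letter.x ^ 2, gen Letter.y ^ 2}

theorem rel_x : (gen Letter.y)⁻¹ * gen Letter.x ^ 2 * gen Letter.y = (gen Letter.x ^ 2)⁻¹ := by
  have h : PresentedGroup.mk relators _ = 1 :=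
    PresentedGroup.one_of_mem (Set.mem_insert _ _)
  exact mul_inv_eq_one.1 h

theorem rel_y : (gen Letter.x)⁻¹ * gen Letter.y ^ 2 * gen Letter.x = (gen Letter.y ^ 2)⁻¹ := by
  have h : PresentedGroup.mk relators _ = 1 :=
    PresentedGroup.one_of_mem (Set.mem_insert_of_mem _ (Set.mem_singleton _))
  exact mul_inv_eq_one.1 h

theorem sq_mem_N (l : Letter) : gen l ^ 2 ∈ N := by
  cases l
  · exact Subgroup.subset_closure (Set.mem_insert _ _)
  · exact Subgroup.subset_closure (Set.mem_insert_of_mem _ (Set.mem_singleton _))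

theorem conj_inv_mem_N (l : Letter) (n : Gam) (hn : n ∈ N) : (gen l)⁻¹ * n * gen l ∈ N := by
  have key : N ≤ N.comap (MulAut.conj (gen l)⁻¹).toMonoidHom := by
    refine (Subgroup.closure_le _).2 ?_
    rintro g (rfl | rfl)
    · change (gen l)⁻¹ * gen Letter.x ^ 2 * (gen l)⁻¹⁻¹ ∈ N
      rw [inv_inv]
      cases l
      · have : (gen Letter.x)⁻¹ * gen Letter.x ^ 2 * gen Letter.x = gen Letter.x ^ 2 := by group
        rw [this]; exact sq_mem_N _
      · rw [rel_x]; exact N.inv_mem (sq_mem_N _)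
    · change (gen l)⁻¹ * gen Letter.y ^ 2 * (gen l)⁻¹⁻¹ ∈ N
      rw [inv_inv]
      cases l
      · rw [rel_y]; exact N.inv_mem (sq_mem_N _)
      · have : (gen Letter.y)⁻¹ * gen Letter.y ^ 2 * gen Letter.y = gen Letter.y ^ 2 := by group
        rw [this]; exact sq_mem_N _
  have h := key hn
  change (gen l)⁻¹ * n * (gen l)⁻¹⁻¹ ∈ N at h
  rwa [inv_inv] at h

theorem conj_mem_N (l : Letter) (n : Gam) (hn : n ∈ N) : gen l * n * (gen l)⁻¹ ∈ N := by
  have h := N.mul_mem (N.mul_mem (sq_mem_N l) (conj_inv_mem_N l n hn)) (N.inv_mem (sq_mem_N l))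
  have e : gen l ^ 2 * ((gen l)⁻¹ * n * gen l) * (gen l ^ 2)⁻¹ = gen l * n * (gen l)⁻¹ := by
    group
  rwa [e] at h

theorem closure_gen : Subgroup.closure (Set.range gen) = ⊤ :=
  PresentedGroup.closure_range_of relators

instance N_normal : N.Normal := by
  rw [← Subgroup.normalizer_eq_top_iff, eq_top_iff, ← closure_gen, Subgroup.closure_le]
  rintro _ ⟨l, rfl⟩
  refine Subgroup.mem_normalizer_iff.2 fun h => ⟨conj_mem_N l h, fun hh => ?_⟩
  have := conj_inv_mem_N l _ hh
  have e : (gen l)⁻¹ * (gen l * h * (gen l)⁻¹) * gen l = h := by group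
  rwa [e] at this

/-- The set `W` of alternating words in the letters `x` and `y`: no two neighbouring letters are
equal. The empty word is included. -/
def W : Type := {w : List Letter // w.IsChain (· ≠ ·)}

/-- The element of `Γ` that a list of letters spells. -/
def eval (w : List Letter) : Gam := (w.map gen).prod

/-- An auxiliary action of `Γ` on `ℤ`, through the reflections of the integer line given by
`v ↦ 1 - v` (for `x`) and `v ↦ -1 - v` (for `y`). -/
def refl : Letter → Equiv.Perm ℤ
  | Letter.x => Equiv.subLeft 1
  | Letter.y => Equiv.subLeft (-1)

theorem refl_sq (l : Letter) : refl l ^ 2 = 1 := by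
  ext v
  cases l <;> simp [refl, pow_two]

/-- The homomorphism from `Γ` to the permutations of `ℤ` that extends `refl`. -/
def act : Gam →* Equiv.Perm ℤ :=
  PresentedGroup.toGroup (f := refl) (rels := relators) (by
    rintro r (rfl | rfl) <;> simp [refl_sq])

theorem act_gen (l : Letter) : act (gen l) = refl l := PresentedGroup.toGroup.of _

theorem act_N {n : Gam} (hn : n ∈ N) : act n = 1 := by
  have : N ≤ act.ker := by
    refine (Subgroup.closure_le _).2 ?_
    rintro g (rfl | rfl) <;> simp [MonoidHom.mem_ker, act_gen, refl_sq]
  exact this hn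

theorem act_eval_cons (l : Letter) (w : List Letter) (hw : (l :: w).IsChain (· ≠ ·)) :
    act (eval (l :: w)) 0 =
      match l with
      | Letter.x => ((l :: w).length : ℤ)
      | Letter.y => -((l :: w).length : ℤ) := by
  induction w generalizing l with
  | nil => cases l <;> simp [eval, act_gen, refl]
  | cons m w ih =>
    have h := List.isChain_cons_cons.1 hw
    have e : act (eval (l :: m :: w)) 0 = refl l (act (eval (m :: w)) 0) := by
      simp [eval, act_gen]
    rw [e, ih m h.2]
    cases l <;> cases m <;> simp [refl] at h ⊢ <;> ring

theorem eval_injective (v w : List Letter) (hv : v.IsChain (· ≠ ·)) (hw : w.IsChain (· ≠ ·))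
    (h : act (eval v) 0 = act (eval w) 0) : v = w := by
  induction v generalizing w with
  | nil =>
    cases w with
    | nil => rfl
    | cons m w =>
      rw [act_eval_cons m w hw] at h
      cases m <;> simp [eval] at h <;> omega
  | cons l v ih =>
    cases w with
    | nil =>
      rw [act_eval_cons l v hv] at h
      cases l <;> simp [eval] at h <;> omega
    | cons m w =>
      have hlm : l = m := by
        have h' := h
        rw [act_eval_cons l v hv, act_eval_cons m w hw] at h'
        cases l <;> cases m <;> simp at h' ⊢ <;> omega
      subst hlm
      have e : ∀ u, act (eval (l :: u)) 0 = refl l (act (eval u) 0) := by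
        intro u; simp [eval, act_gen]
      rw [e, e] at h
      rw [ih w hv.tail hw.tail ((refl l).injective h)]

theorem exists_word_gen_mul (l : Letter) (g : Gam)
    (hg : ∃ w : W, g * (eval w.1)⁻¹ ∈ N) : ∃ w : W, gen l * g * (eval w.1)⁻¹ ∈ N := by
  classical
  obtain ⟨⟨w, hw⟩, h⟩ := hg
  have h1 := conj_mem_N l _ h
  by_cases hc : (l :: w).IsChain (· ≠ ·)
  · refine ⟨⟨l :: w, hc⟩, ?_⟩
    have e : gen l * (g * (eval w)⁻¹) * (gen l)⁻¹ = gen l * g * (eval (l :: w))⁻¹ := by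
      simp [eval, mul_assoc]
    rwa [e] at h1
  · cases w with
    | nil => simp at hc
    | cons m u =>
      have hlm : l = m := by
        by_contra hne
        exact hc (List.isChain_cons_cons.2 ⟨hne, hw⟩)
      subst hlm
      refine ⟨⟨u, hw.tail⟩, ?_⟩
      have h2 := N.mul_mem h1 (sq_mem_N l)
      have e' : eval (l :: u) = gen l * eval u := by simp [eval]
      have e : gen l * (g * (gen l * eval u)⁻¹) * (gen l)⁻¹ * gen l ^ 2 =
          gen l * g * (eval u)⁻¹ := by group
      rw [e', e] at h2
      exact h2

theorem exists_word (g : Gam) : ∃ w : W, g * (eval w.1)⁻¹ ∈ N := by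
  have hg : g ∈ Subgroup.closure (Set.range gen) := by rw [closure_gen]; trivial
  induction hg using Subgroup.closure_induction_left with
  | one => exact ⟨⟨[], List.isChain_nil⟩, by simp [eval, N.one_mem]⟩
  | mul_left z hz g _ ih =>
    obtain ⟨l, rfl⟩ := hz
    exact exists_word_gen_mul l g ih
  | inv_mul_cancel z hz g _ ih =>
    obtain ⟨l, rfl⟩ := hz
    obtain ⟨w, hw⟩ := exists_word_gen_mul l g ih
    refine ⟨w, ?_⟩
    have h := N.mul_mem (N.inv_mem (sq_mem_N l)) hw
    have e : (gen l ^ 2)⁻¹ * (gen l * g * (eval w.1)⁻¹) = (gen l)⁻¹ * g * (eval w.1)⁻¹ := by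
      group
    rwa [e] at h

/-- The alternating words form a transversal for `N` in `Γ`: every `g` lies in the coset `N w`
of exactly one alternating word `w`. -/
theorem existsUnique_word (g : Gam) : ∃! w : W, g * (eval w.1)⁻¹ ∈ N := by
  obtain ⟨w, hw⟩ := exists_word g
  refine ⟨w, hw, fun v hv => Subtype.ext ?_⟩
  have key : ∀ u : W, g * (eval u.1)⁻¹ ∈ N → act (eval u.1) = act g := by
    intro u hu
    have h := act_N hu
    rw [map_mul, map_inv] at h
    exact (mul_inv_eq_one.1 h).symm
  exact eval_injective _ _ v.2 w.2 (by rw [key v hv, key w hw])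

/-- The unique alternating word `w` with `g ∈ N w`. -/
noncomputable def word (g : Gam) : W := (existsUnique_word g).choose

/-- The length `L(g)` of `g ∈ Γ`: the number of letters of the alternating word `w` with
`g ∈ N w`. -/
noncomputable def len (g : Gam) : ℕ := (word g).1.length

/-- The length `L(σ)` of `σ ∈ KΓ`: the maximum of `L(g)` over the support of `σ`, and `-∞`
(that is, `⊥`) if `σ = 0`. -/
noncomputable def length {K : Type*} [Field K] (σ : MonoidAlgebra K Gam) : WithBot ℕ :=
  σ.coeff.support.sup fun g => (len g : WithBot ℕ)

/-- The trivial units `λ g` of `KΓ`, where `λ ∈ K` is non-zero and `g ∈ Γ`. -/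
def IsTrivialUnit {K : Type*} [Field K] (σ : MonoidAlgebra K Gam) : Prop :=
  ∃ (c : K) (g : Gam), c ≠ 0 ∧ σ = MonoidAlgebra.single g c

end FoursGroup

/-! Put `a = x²`, `b = y²`. Then `KN` is the ring of Laurent polynomials in `a` and `b`, a unique
factorization domain, and `KΓ` is a free left `KN`-module on the alternating words; `x` and `y` act
on `KN` by the involutions `sx` and `sy`. A factor `s + t x` has the conjugate `sx s - t x`, and
their product is the norm `s sx(s) - a t sx(t)`. The two terms have top degrees in `a` of different
parity, so the norm vanishes only for `s = t = 0`, and it is a unit only if `s = 0` or `t = 0`. The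
same holds for `y` and `b`.

Call an element right regular if it has a right multiple in `KN` other than zero. Units are right
regular, and right regularity, unlike invertibility, survives right multiplication by any non-zero
`s + t x` or `s + t y`. Comparing longest words shows that a right regular element of length at most
3 cannot involve both words of its maximal positive length (`leading_three`, `leading_two`,
`leading_one`). By the symmetry of `x` and `y`, the word `yxy` may be assumed absent from the unit
`σ`.

Cancelling the word `xyx` by a suitable right factor then forces a determinant to vanish
(`relation_three`). By unique factorization the part of `σ` that involves `y` is a product `M y E`,
with `M` and `E` in `KN + KN x` and the coefficients of `E` coprime up to conjugation. Right
multiplication by the conjugate `E'` of `E` removes `yx` and `xyx`; a second determinant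
(`relation_two`) gives `σ E' = R (g + c y)` with `g`, `c` coprime. Let `κ` be the norm of `g + c y`
and `F = sy g - c y`. Then `σ E' F = R κ`; inverting `σ` and using that `κ sx(κ)` is central, one
finds that `κ` divides `g` and `c`. So `κ` is a unit (`isUnit_normY_of_isUnit`), and `g = 0` or `c =
0`. In the first case `σ = M y E`, in the second `σ` lies in `KN + KN x`; both reduce to the group
algebra of `⟨N, x⟩`, where the norm settles the matter (`isTrivialUnit_of_mul_eq_one`). -/

namespace FoursGroup

/-! ### Laurent polynomials: top exponents, units and norms. -/

section LaurentPolynomials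

/-- Laurent polynomials in the two commuting variables `a` and `b`; they model `KN`. -/
abbrev Lau (K : Type*) [Field K] : Type _ := AddMonoidAlgebra K (ℤ × ℤ)

variable {K : Type*} [Field K]

open AddMonoidAlgebra

/-- Laurent polynomials in one variable localize a polynomial ring at the powers of the variable,
and localization preserves unique factorization; doing this twice gives two variables. -/
instance Lau.uniqueFactorizationMonoid : UniqueFactorizationMonoid (Lau K) := by
  have h1 : UniqueFactorizationMonoid (LaurentPolynomial K) :=
    .of_isLocalization (Submonoid.powers (Polynomial.X : Polynomial K)) _
  have h2 : UniqueFactorizationMonoid (LaurentPolynomial (LaurentPolynomial K)) :=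
    .of_isLocalization (Submonoid.powers (Polynomial.X : Polynomial (LaurentPolynomial K))) _
  exact (curryRingEquiv (R := K) (M := ℤ) (N := ℤ)).symm.toMulEquiv.uniqueFactorizationMonoid h2

/-- `m` is the exponent in `f` that is maximal with respect to `D`. -/
def IsTop (D : ℤ × ℤ →+ ℤ ×ₗ ℤ) (f : Lau K) (m : ℤ × ℤ) : Prop :=
  f.coeff m ≠ 0 ∧ ∀ n, f.coeff n ≠ 0 → D n ≤ D m

theorem exists_isTop (D : ℤ × ℤ →+ ℤ ×ₗ ℤ) {f : Lau K} (hf : f ≠ 0) : ∃ m, IsTop D f m := by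
  have hs : f.coeff.support.Nonempty := by
    rw [Finsupp.support_nonempty_iff]; simpa using hf
  obtain ⟨m, hm, h⟩ := Finset.exists_max_image f.coeff.support D hs
  exact ⟨m, by simpa using hm, fun n hn => h n (by simpa using hn)⟩

/-- Since `D` is injective and additive, the maximal degree of a product comes from a single pair of
exponents, so nothing cancels there. -/
theorem IsTop.mul {D : ℤ × ℤ →+ ℤ ×ₗ ℤ} (hD : Function.Injective D) {f g : Lau K} {m n : ℤ × ℤ}
    (hf : IsTop D f m) (hg : IsTop D g n) : IsTop D (f * g) (m + n) := by
  classical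
  have hu : UniqueAdd f.coeff.support g.coeff.support m n := by
    intro i j hi hj hij
    have h1 := hf.2 i (by simpa using hi)
    have h2 := hg.2 j (by simpa using hj)
    have h3 : D i + D j = D m + D n := by rw [← map_add, hij, map_add]
    have h4 : D i = D m := by
      refine le_antisymm h1 ?_
      by_contra hlt
      exact (add_lt_add_of_lt_of_le (not_le.1 hlt) h2).ne h3
    have h5 : D j = D n := by rw [h4] at h3; exact add_left_cancel h3
    exact ⟨hD h4, hD h5⟩
  constructor
  · rw [coeff_mul_add_of_uniqueAdd hu]
    exact mul_ne_zero hf.1 hg.1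
  · intro k hk
    have hk' : k ∈ (f * g).coeff.support := Finsupp.mem_support_iff.2 hk
    obtain ⟨i, hi, j, hj, rfl⟩ := Finset.mem_add.1 (support_coeff_mul_subset f g hk')
    rw [map_add, map_add]
    exact add_le_add (hf.2 i (by simpa using hi)) (hg.2 j (by simpa using hj))

theorem IsTop.unique {D : ℤ × ℤ →+ ℤ ×ₗ ℤ} (hD : Function.Injective D) {f : Lau K} {m n : ℤ × ℤ}
    (hm : IsTop D f m) (hn : IsTop D f n) : m = n :=
  hD (le_antisymm (hn.2 m hm.1) (hm.2 n hn.1))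

theorem isTop_one (D : ℤ × ℤ →+ ℤ ×ₗ ℤ) : IsTop D (1 : Lau K) 0 := by
  classical
  constructor
  · simp [one_def]
  · intro n hn
    rw [one_def, coeff_single, Finsupp.single_apply] at hn
    have : 0 = n := by by_contra h; simp [h] at hn
    rw [← this]

/-- The lexicographic order of exponents in which `a` comes first. -/
def lexFst : ℤ × ℤ →+ ℤ ×ₗ ℤ where
  toFun m := toLex m
  map_zero' := rfl
  map_add' _ _ := rfl

/-- The lexicographic order of exponents in which `b` comes first. -/
def lexSnd : ℤ × ℤ →+ ℤ ×ₗ ℤ where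
  toFun m := toLex (m.2, m.1)
  map_zero' := rfl
  map_add' _ _ := rfl

theorem lexFst_injective : Function.Injective lexFst := fun _ _ h => h

theorem lexSnd_injective : Function.Injective lexSnd := fun m n h => by
  have h' : (m.2, m.1) = (n.2, n.1) := h
  rw [Prod.mk.injEq] at h'
  exact Prod.ext h'.2 h'.1

theorem neg_lex_injective {D : ℤ × ℤ →+ ℤ ×ₗ ℤ} (hD : Function.Injective D) :
    Function.Injective (-D) := fun _ _ h => hD (neg_injective h)

/-- Every unit of the ring of Laurent polynomials is a monomial. -/
theorem exists_single_of_isUnit {f : Lau K} (hf : IsUnit f) :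
    ∃ m c, c ≠ 0 ∧ f = single m c := by
  classical
  obtain ⟨g, hfg⟩ := hf.exists_right_inv
  have hf0 : f ≠ 0 := hf.ne_zero
  have hg0 : g ≠ 0 := by rintro rfl; simp at hfg
  obtain ⟨m, hm⟩ := exists_isTop lexFst hf0
  obtain ⟨n, hn⟩ := exists_isTop lexFst hg0
  obtain ⟨m', hm'⟩ := exists_isTop (-lexFst) hf0
  obtain ⟨n', hn'⟩ := exists_isTop (-lexFst) hg0
  have h1 := hm.mul lexFst_injective hn
  have h2 := hm'.mul (neg_lex_injective lexFst_injective) hn'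
  rw [hfg] at h1 h2
  have h3 := h1.unique lexFst_injective (isTop_one _)
  have h4 := h2.unique (neg_lex_injective lexFst_injective) (isTop_one _)
  have h5 : lexFst m' ≤ lexFst m := hm.2 _ hm'.1
  have h6 : lexFst n' ≤ lexFst n := hn.2 _ hn'.1
  -- The top exponents of `f` and `g` add up to `0`, and so do the bottom ones; hence top and bottom
  -- of `f` coincide.
  have h7 : lexFst m' + lexFst n' = lexFst m + lexFst n := by
    rw [← map_add, ← map_add, h3, h4]
  have h8 : lexFst m' = lexFst m := by
    refine le_antisymm h5 ?_
    by_contra hlt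
    exact (add_lt_add_of_lt_of_le (not_le.1 hlt) h6).ne h7
  refine ⟨m, f.coeff m, hm.1, ?_⟩
  ext k
  rw [coeff_single, Finsupp.single_apply]
  split_ifs with h
  · rw [h]
  · by_contra hk
    have h9 := hm.2 k hk
    have h10 : -lexFst k ≤ -lexFst m' := hm'.2 k hk
    rw [h8] at h10
    exact h (lexFst_injective (le_antisymm (neg_le_neg_iff.1 h10) h9))

/-- The norm `p pᵉ - c q qᵉ` for the automorphism induced by an automorphism `e` of the
exponents, where `c` is the monomial with exponent `c`. -/
noncomputable def normOf (e : ℤ × ℤ ≃+ ℤ × ℤ) (c : ℤ × ℤ) (p q : Lau K) : Lau K :=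
  p * domCongr K K e p - single c 1 * q * domCongr K K e q

theorem coeff_domCongr (e : ℤ × ℤ ≃+ ℤ × ℤ) (p : Lau K) (m : ℤ × ℤ) :
    (domCongr K K e p).coeff (e m) = p.coeff m := by
  simp

/-- The exponents of a product `p pᵉ`, if `e` preserves the degree that comes first in `D`. -/
theorem exists_isTop_mul_domCongr {D : ℤ × ℤ →+ ℤ ×ₗ ℤ} (hD : Function.Injective D)
    (e : ℤ × ℤ ≃+ ℤ × ℤ) (he : ∀ m, (ofLex (D (e m))).1 = (ofLex (D m)).1)
    {p : Lau K} (hp : p ≠ 0) :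
    ∃ m n, p.coeff m ≠ 0 ∧ IsTop D (p * domCongr K K e p) n ∧
      (ofLex (D n)).1 = 2 * (ofLex (D m)).1 ∧
      ∀ k, p.coeff k ≠ 0 → (ofLex (D k)).1 ≤ (ofLex (D m)).1 := by
  obtain ⟨m, hm⟩ := exists_isTop D hp
  have hq : domCongr K K e p ≠ 0 := by
    rw [Ne, EmbeddingLike.map_eq_zero_iff]; exact hp
  obtain ⟨n, hn⟩ := exists_isTop D hq
  have mono : ∀ {r s : ℤ × ℤ}, D r ≤ D s → (ofLex (D r)).1 ≤ (ofLex (D s)).1 := fun h =>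
    Prod.Lex.monotone_fst _ _ h
  refine ⟨m, m + n, hm.1, hm.mul hD hn, ?_, fun k hk => mono (hm.2 k hk)⟩
  have h1 : (ofLex (D (e m))).1 ≤ (ofLex (D n)).1 :=
    mono (hn.2 _ (by rw [coeff_domCongr]; exact hm.1))
  -- The image `e m` need not be the top exponent of the conjugate, but its leading degree is the
  -- right one because `e` preserves that degree.
  have h2 : (ofLex (D n)).1 ≤ (ofLex (D m)).1 := by
    have hn1 := hn.1
    obtain ⟨n, rfl⟩ := e.surjective n
    rw [coeff_domCongr] at hn1
    rw [he]
    exact mono (hm.2 _ hn1)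
  rw [he] at h1
  have h3 : (ofLex (D (m + n))).1 = (ofLex (D m)).1 + (ofLex (D n)).1 := by
    rw [map_add]; rfl
  omega

theorem isTop_single_mul {D : ℤ × ℤ →+ ℤ ×ₗ ℤ} (hD : Function.Injective D) (c : ℤ × ℤ)
    {f : Lau K} {m : ℤ × ℤ} (hf : IsTop D f m) : IsTop D (single c 1 * f) (c + m) := by
  classical
  refine IsTop.mul hD ⟨by simp, fun n hn => ?_⟩ hf
  rw [coeff_single, Finsupp.single_apply] at hn
  have : c = n := by by_contra h; simp [h] at hn
  rw [← this]

/-- The difference of two Laurent polynomials with top exponents of different degree. -/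
theorem coeff_sub_ne_zero {D : ℤ × ℤ →+ ℤ ×ₗ ℤ} {f g : Lau K} {m n : ℤ × ℤ}
    (hf : IsTop D f m) (hg : IsTop D g n) (h : D n < D m) : (f - g).coeff m ≠ 0 := by
  have : g.coeff m = 0 := by
    by_contra h0
    exact absurd (hg.2 m h0) (not_le.2 h)
  rw [coeff_sub, Finsupp.sub_apply, this, sub_zero]
  exact hf.1

/-- The products `p pᵉ` and `q qᵉ` have even top degree while `c` has odd degree, so the leading
terms of the two summands cannot cancel. -/
theorem normOf_top {D : ℤ × ℤ →+ ℤ ×ₗ ℤ} (hD : Function.Injective D)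
    (e : ℤ × ℤ ≃+ ℤ × ℤ) (he : ∀ m, (ofLex (D (e m))).1 = (ofLex (D m)).1) (c : ℤ × ℤ)
    (hc : Odd (ofLex (D c)).1) {p q : Lau K} (hp : p ≠ 0) (hq : q ≠ 0) :
    ∃ m n k, p.coeff m ≠ 0 ∧ q.coeff n ≠ 0 ∧
      (∀ k, p.coeff k ≠ 0 → (ofLex (D k)).1 ≤ (ofLex (D m)).1) ∧
      (∀ k, q.coeff k ≠ 0 → (ofLex (D k)).1 ≤ (ofLex (D n)).1) ∧
      (normOf e c p q).coeff k ≠ 0 ∧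
      (ofLex (D k)).1 = max (2 * (ofLex (D m)).1) ((ofLex (D c)).1 + 2 * (ofLex (D n)).1) := by
  obtain ⟨m, m', hm, htm, hmm, hmk⟩ := exists_isTop_mul_domCongr hD e he hp
  obtain ⟨n, n', hn, htn, hnn, hnk⟩ := exists_isTop_mul_domCongr hD e he hq
  have htn' := isTop_single_mul hD c htn
  rw [← mul_assoc] at htn'
  have hadd : (ofLex (D (c + n'))).1 = (ofLex (D c)).1 + (ofLex (D n')).1 := by
    rw [map_add]; rfl
  obtain ⟨r, hr⟩ := hc
  rcases lt_or_gt_of_ne (show (ofLex (D m')).1 ≠ (ofLex (D (c + n'))).1 by omega) with h | h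
  · refine ⟨m, n, c + n', hm, hn, hmk, hnk, ?_, ?_⟩
    · have := coeff_sub_ne_zero htn' htm (Prod.Lex.lt_iff.2 (Or.inl h))
      rw [← neg_sub, coeff_neg, Finsupp.neg_apply, neg_ne_zero] at this
      exact this
    · rw [max_eq_right] <;> omega
  · refine ⟨m, n, m', hm, hn, hmk, hnk, coeff_sub_ne_zero htm htn' (Prod.Lex.lt_iff.2 (Or.inl h)), ?_⟩
    rw [max_eq_left] <;> omega

theorem normOf_ne_zero {D : ℤ × ℤ →+ ℤ ×ₗ ℤ} (hD : Function.Injective D)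
    (e : ℤ × ℤ ≃+ ℤ × ℤ) (he : ∀ m, (ofLex (D (e m))).1 = (ofLex (D m)).1) (c : ℤ × ℤ)
    (hc : Odd (ofLex (D c)).1) {p q : Lau K} (h : p ≠ 0 ∨ q ≠ 0) : normOf e c p q ≠ 0 := by
  have hinj : ∀ r : Lau K, r ≠ 0 → domCongr K K e r ≠ 0 := fun r hr => by
    rw [Ne, EmbeddingLike.map_eq_zero_iff]; exact hr
  have hs : (single c 1 : Lau K) ≠ 0 := by simp
  by_cases hp : p = 0
  · have hq : q ≠ 0 := h.resolve_left (not_not.2 hp)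
    simpa [normOf, hp] using hq
  by_cases hq : q = 0
  · simpa [normOf, hq] using hp
  obtain ⟨_, _, k, -, -, -, -, hk, -⟩ := normOf_top hD e he c hc hp hq
  intro h0
  simp [h0] at hk

/-- A unit is a monomial, so top and bottom degrees of the norm agree. If `p` and `q` were both
non-zero, this common degree would be squeezed between the degrees of `p pᵉ`, making it even, and
between those of the other summand, making it odd. The bottom degree is the top degree for `-D`. -/
theorem eq_zero_or_eq_zero_of_isUnit_normOf {D : ℤ × ℤ →+ ℤ ×ₗ ℤ} (hD : Function.Injective D)
    (e : ℤ × ℤ ≃+ ℤ × ℤ) (he : ∀ m, (ofLex (D (e m))).1 = (ofLex (D m)).1) (c : ℤ × ℤ)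
    (hc : Odd (ofLex (D c)).1) {p q : Lau K} (h : IsUnit (normOf e c p q)) : p = 0 ∨ q = 0 := by
  classical
  by_contra! hpq
  have hneg : ∀ m, (ofLex ((-D) m)).1 = -(ofLex (D m)).1 := fun m => rfl
  obtain ⟨m, n, k, hm, hn, hmk, hnk, hk, hkk⟩ := normOf_top hD e he c hc hpq.1 hpq.2
  obtain ⟨m', n', k', hm', hn', hmk', hnk', hk', hkk'⟩ :=
    normOf_top (neg_lex_injective hD) e (fun m => by rw [hneg, hneg, he]) c
      (by rw [hneg]; exact hc.neg) hpq.1 hpq.2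
  obtain ⟨s, d, hd, hs⟩ := exists_single_of_isUnit h
  have key : ∀ j, (normOf e c p q).coeff j ≠ 0 → j = s := by
    intro j hj
    rw [hs, coeff_single, Finsupp.single_apply] at hj
    by_contra h'
    exact hj (if_neg (Ne.symm h'))
  rw [key k hk] at hkk
  rw [key k' hk'] at hkk'
  simp only [hneg] at hkk'
  have h1 := hmk _ hm'
  have h2 := hnk _ hn'
  obtain ⟨r, hr⟩ := hc
  omega

variable (K) in
/-- Conjugation by `x` on `KN`: it fixes `a` and inverts `b`. -/
noncomputable def sx : Lau K →+* Lau K :=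
  (domCongr K K ((AddEquiv.refl ℤ).prodCongr (AddEquiv.neg ℤ)) : Lau K ≃ₐ[K] Lau K)

variable (K) in
/-- Conjugation by `y` on `KN`: it inverts `a` and fixes `b`. -/
noncomputable def sy : Lau K →+* Lau K :=
  (domCongr K K ((AddEquiv.neg ℤ).prodCongr (AddEquiv.refl ℤ)) : Lau K ≃ₐ[K] Lau K)

theorem sx_single (i j : ℤ) (c : K) : sx K (single (i, j) c) = single (i, -j) c := by
  simp [sx, AddEquiv.prodCongr]

theorem sy_single (i j : ℤ) (c : K) : sy K (single (i, j) c) = single (-i, j) c := by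
  simp [sy, AddEquiv.prodCongr]

@[simp] theorem sx_sx (p : Lau K) : sx K (sx K p) = p := by
  induction p using AddMonoidAlgebra.induction_linear with
  | zero => simp
  | add f g hf hg => rw [map_add, map_add, hf, hg]
  | single m c => rw [sx_single, sx_single, neg_neg]

@[simp] theorem sy_sy (p : Lau K) : sy K (sy K p) = p := by
  induction p using AddMonoidAlgebra.induction_linear with
  | zero => simp
  | add f g hf hg => rw [map_add, map_add, hf, hg]
  | single m c => rw [sy_single, sy_single, neg_neg]

@[simp] theorem sy_sx (p : Lau K) : sy K (sx K p) = sx K (sy K p) := by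
  induction p using AddMonoidAlgebra.induction_linear with
  | zero => simp
  | add f g hf hg => simp only [map_add, hf, hg]
  | single m c => rw [sx_single, sy_single, sy_single, sx_single]

variable (K) in
/-- The variable `a`, which stands for `x²`. -/
noncomputable def va : Lau K := single (1, 0) 1

variable (K) in
/-- The variable `b`, which stands for `y²`. -/
noncomputable def vb : Lau K := single (0, 1) 1

variable (K) in
/-- The inverse of the variable `a`. -/
noncomputable def vai : Lau K := single (-1, 0) 1

variable (K) in
/-- The inverse of the variable `b`. -/
noncomputable def vbi : Lau K := single (0, -1) 1

@[simp] theorem sx_va : sx K (va K) = va K := by simp [va, sx_single]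
@[simp] theorem sy_va : sy K (va K) = vai K := by simp [va, vai, sy_single]
@[simp] theorem sx_vai : sx K (vai K) = vai K := by simp [vai, sx_single]
@[simp] theorem sy_vai : sy K (vai K) = va K := by simp [va, vai, sy_single]
@[simp] theorem sx_vb : sx K (vb K) = vbi K := by simp [vb, vbi, sx_single]
@[simp] theorem sy_vb : sy K (vb K) = vb K := by simp [vb, sy_single]
@[simp] theorem sx_vbi : sx K (vbi K) = vb K := by simp [vb, vbi, sx_single]
@[simp] theorem sy_vbi : sy K (vbi K) = vbi K := by simp [vbi, sy_single]

theorem va_mul_vai : va K * vai K = 1 := by simp [va, vai, single_mul_single, one_def, ← Prod.zero_eq_mk]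
theorem vb_mul_vbi : vb K * vbi K = 1 := by simp [vb, vbi, single_mul_single, one_def, ← Prod.zero_eq_mk]

theorem va_ne_zero : va K ≠ 0 := by simp [va]
theorem vb_ne_zero : vb K ≠ 0 := by simp [vb]

@[simp] theorem sx_eq_zero {p : Lau K} : sx K p = 0 ↔ p = 0 :=
  ⟨fun h => by rw [← sx_sx p, h, map_zero], fun h => by rw [h, map_zero]⟩

@[simp] theorem sy_eq_zero {p : Lau K} : sy K p = 0 ↔ p = 0 :=
  ⟨fun h => by rw [← sy_sy p, h, map_zero], fun h => by rw [h, map_zero]⟩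

theorem normX_eq (p q : Lau K) : p * sx K p - va K * q * sx K q =
    normOf ((AddEquiv.refl ℤ).prodCongr (AddEquiv.neg ℤ)) (1, 0) p q := rfl

theorem normY_eq (p q : Lau K) : p * sy K p - vb K * q * sy K q =
    normOf ((AddEquiv.neg ℤ).prodCongr (AddEquiv.refl ℤ)) (0, 1) p q := rfl

theorem normX_ne_zero {p q : Lau K} (h : p ≠ 0 ∨ q ≠ 0) :
    p * sx K p - va K * q * sx K q ≠ 0 := by
  rw [normX_eq]
  exact normOf_ne_zero lexFst_injective _ (fun _ => rfl) _ odd_one h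

theorem normY_ne_zero {p q : Lau K} (h : p ≠ 0 ∨ q ≠ 0) :
    p * sy K p - vb K * q * sy K q ≠ 0 := by
  rw [normY_eq]
  exact normOf_ne_zero lexSnd_injective _ (fun _ => rfl) _ odd_one h

theorem eq_zero_or_eq_zero_of_isUnit_normX {p q : Lau K}
    (h : IsUnit (p * sx K p - va K * q * sx K q)) : p = 0 ∨ q = 0 := by
  rw [normX_eq] at h
  exact eq_zero_or_eq_zero_of_isUnit_normOf lexFst_injective _ (fun _ => rfl) _ odd_one h

theorem eq_zero_or_eq_zero_of_isUnit_normY {p q : Lau K}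
    (h : IsUnit (p * sy K p - vb K * q * sy K q)) : p = 0 ∨ q = 0 := by
  rw [normY_eq] at h
  exact eq_zero_or_eq_zero_of_isUnit_normOf lexSnd_injective _ (fun _ => rfl) _ odd_one h

end LaurentPolynomials

/-! ### Coprime pairs and matrices of rank at most one over a factorial domain. -/

section RankOne

variable {A : Type*} [CommRing A] [IsDomain A] [UniqueFactorizationMonoid A]

/-- A vector that is proportional to a primitive one is a multiple of it. -/
theorem exists_eq_mul_of_isRelPrime {k l p q : A} (h : IsRelPrime k l) (e : p * l = q * k) :
    ∃ r, p = r * k ∧ q = r * l := by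
  by_cases hk : k = 0
  · subst hk
    have hl : IsUnit l := isRelPrime_zero_left.1 h
    obtain ⟨l', hl'⟩ := hl.exists_right_inv
    refine ⟨q * l', ?_, ?_⟩
    · rw [mul_zero] at e ⊢
      exact (mul_eq_zero.1 e).resolve_right hl.ne_zero
    · rw [mul_assoc, mul_comm l', hl', mul_one]
  · have hd : k ∣ p := h.dvd_of_dvd_mul_right (Dvd.intro_left q e.symm)
    obtain ⟨r, rfl⟩ := hd
    refine ⟨r, mul_comm _ _, mul_left_cancel₀ hk ?_⟩
    linear_combination -e

/-- Coprime elements need not generate the unit ideal here, so a Bézout argument is not available.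
Instead the two quotients by `c` are proportional to `(k, l)`, and the factor of proportionality is
the quotient of `f`. -/
theorem dvd_of_dvd_mul_of_dvd_mul {k l c f : A} (h : IsRelPrime k l)
    (hk : c ∣ k * f) (hl : c ∣ l * f) : c ∣ f := by
  obtain ⟨r, hr⟩ := hk
  obtain ⟨s, hs⟩ := hl
  by_cases hc : c = 0
  · subst hc
    rw [zero_mul] at hr hs
    by_contra hf
    have hf : f ≠ 0 := fun h0 => hf (h0 ▸ dvd_refl _)
    have h1 := (mul_eq_zero.1 hr).resolve_right hf
    have h2 := (mul_eq_zero.1 hs).resolve_right hf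
    subst h1; subst h2
    exact not_isUnit_zero (isRelPrime_zero_left.1 h)
  · obtain ⟨t, rfl, rfl⟩ := exists_eq_mul_of_isRelPrime (p := r) (q := s) h
      (mul_left_cancel₀ hc (by linear_combination k * hs - l * hr))
    by_cases hk : k = 0
    · have hl : l ≠ 0 := by
        rintro rfl
        subst hk
        exact not_isUnit_zero (isRelPrime_zero_left.1 h)
      exact ⟨t, mul_left_cancel₀ hl (by linear_combination hs)⟩
    · exact ⟨t, mul_left_cancel₀ hk (by linear_combination hr)⟩

/-- A `2 × 2` matrix of determinant zero is the product of a column and a primitive row. -/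
theorem exists_rankOne {v t u w : A} (h : t * u = v * w) :
    ∃ k l m n, IsRelPrime k l ∧ v = m * k ∧ t = m * l ∧ u = n * k ∧ w = n * l := by
  have red : ∀ p q : A, p ≠ 0 ∨ q ≠ 0 → ∃ k l m, IsRelPrime k l ∧ m ≠ 0 ∧ p = m * k ∧ q = m * l := by
    rintro p q (hp | hq)
    · obtain ⟨k, l, m, hr, rfl, rfl⟩ := UniqueFactorizationMonoid.exists_reduced_factors p hp q
      exact ⟨k, l, m, hr, left_ne_zero_of_mul hp, rfl, rfl⟩
    · obtain ⟨k, l, m, hr, rfl, rfl⟩ := UniqueFactorizationMonoid.exists_reduced_factors' p q hq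
      exact ⟨k, l, m, hr, left_ne_zero_of_mul hq, rfl, rfl⟩
  by_cases h1 : v ≠ 0 ∨ t ≠ 0
  · obtain ⟨k, l, m, hr, hm, rfl, rfl⟩ := red v t h1
    obtain ⟨n, rfl, rfl⟩ := exists_eq_mul_of_isRelPrime (p := u) (q := w) hr
      (mul_left_cancel₀ hm (by linear_combination h))
    exact ⟨k, l, m, n, hr, rfl, rfl, rfl, rfl⟩
  · push Not at h1
    obtain ⟨rfl, rfl⟩ := h1
    by_cases h2 : u ≠ 0 ∨ w ≠ 0
    · obtain ⟨k, l, m, hr, hm, rfl, rfl⟩ := red u w h2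
      exact ⟨k, l, 0, m, hr, by simp, by simp, rfl, rfl⟩
    · push Not at h2
      obtain ⟨rfl, rfl⟩ := h2
      -- For the zero matrix any primitive row will do.
      exact ⟨1, 0, 0, 0, isRelPrime_one_left, by simp, by simp, by simp, by simp⟩

end RankOne

/-! ### `KΓ` as a left module over the Laurent polynomials. -/

section GroupAlgebra

variable (K : Type*) [Field K]

/-- The generator `x` as an element of `KΓ`. -/
noncomputable def gX : MonoidAlgebra K Gam := MonoidAlgebra.of K Gam (gen Letter.x)

/-- The generator `y` as an element of `KΓ`. -/
noncomputable def gY : MonoidAlgebra K Gam := MonoidAlgebra.of K Gam (gen Letter.y)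

theorem semiconj_x : SemiconjBy (gen Letter.x) (gen Letter.y ^ 2) (gen Letter.y ^ 2)⁻¹ := by
  have h := rel_y
  have h' : (gen Letter.x)⁻¹ * (gen Letter.y ^ 2)⁻¹ * gen Letter.x = gen Letter.y ^ 2 := by
    simpa [mul_assoc] using congrArg (·⁻¹) h
  simpa [mul_assoc, SemiconjBy] using (congrArg (gen Letter.x * ·) h').symm

theorem semiconj_y : SemiconjBy (gen Letter.y) (gen Letter.x ^ 2) (gen Letter.x ^ 2)⁻¹ := by
  have h := rel_x
  have h' : (gen Letter.y)⁻¹ * (gen Letter.x ^ 2)⁻¹ * gen Letter.y = gen Letter.x ^ 2 := by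
    simpa [mul_assoc] using congrArg (·⁻¹) h
  simpa [mul_assoc, SemiconjBy] using (congrArg (gen Letter.y * ·) h').symm

/-- Conjugation by `x` inverts `y²`, so conjugation by `x²` fixes it. -/
theorem commute_sq : Commute (gen Letter.x ^ 2) (gen Letter.y ^ 2) := by
  have h := semiconj_x.inv_right.mul_left semiconj_x
  rwa [inv_inv, ← pow_two] at h

/-- The homomorphism `(i, j) ↦ x²ⁱ y²ʲ` from `ℤ × ℤ` to `Γ`. -/
def nu : Multiplicative (ℤ × ℤ) →* Gam where
  toFun m := (gen Letter.x ^ 2) ^ (m.toAdd.1) * (gen Letter.y ^ 2) ^ (m.toAdd.2)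
  map_one' := by simp
  map_mul' m n := by
    simp only [toAdd_mul, Prod.fst_add, Prod.snd_add, zpow_add]
    have := (commute_sq.zpow_zpow n.toAdd.1 m.toAdd.2).eq
    rw [mul_assoc, mul_assoc, ← mul_assoc _ ((gen Letter.y ^ 2) ^ _) ((gen Letter.y ^ 2) ^ _), this]
    simp only [mul_assoc]

theorem nu_apply (i j : ℤ) :
    nu (Multiplicative.ofAdd (i, j)) = (gen Letter.x ^ 2) ^ i * (gen Letter.y ^ 2) ^ j := rfl

theorem N_le_range_nu : N ≤ nu.range := by
  refine (Subgroup.closure_le _).2 ?_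
  rintro g (rfl | rfl)
  · exact ⟨Multiplicative.ofAdd (1, 0), by simp [nu_apply]⟩
  · exact ⟨Multiplicative.ofAdd (0, 1), by simp [nu_apply]⟩

theorem x_mul_nu (i j : ℤ) : gen Letter.x * nu (Multiplicative.ofAdd (i, j)) =
    nu (Multiplicative.ofAdd (i, -j)) * gen Letter.x := by
  have h1 : Commute (gen Letter.x) ((gen Letter.x ^ 2) ^ i) :=
    ((Commute.refl _).pow_right 2).zpow_right i
  have h2 := semiconj_x.zpow_right j
  rw [nu_apply, nu_apply, zpow_neg, ← inv_zpow]
  exact SemiconjBy.mul_right h1 h2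

theorem y_mul_nu (i j : ℤ) : gen Letter.y * nu (Multiplicative.ofAdd (i, j)) =
    nu (Multiplicative.ofAdd (-i, j)) * gen Letter.y := by
  have h1 : Commute (gen Letter.y) ((gen Letter.y ^ 2) ^ j) :=
    ((Commute.refl _).pow_right 2).zpow_right j
  have h2 := semiconj_y.zpow_right i
  rw [nu_apply, nu_apply, zpow_neg, ← inv_zpow]
  exact h2.mul_right h1

/-- The embedding of the ring of Laurent polynomials into `KΓ` with image `KN`. -/
noncomputable def iota : Lau K →ₐ[K] MonoidAlgebra K Gam :=
  AddMonoidAlgebra.lift K _ _ ((MonoidAlgebra.of K Gam).comp nu)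

variable {K}

theorem iota_single (m : ℤ × ℤ) (c : K) :
    iota K (AddMonoidAlgebra.single m c) = MonoidAlgebra.single (nu (Multiplicative.ofAdd m)) c := by
  simp [iota, AddMonoidAlgebra.lift_single, MonoidAlgebra.smul_single]

theorem gX_mul_iota (p : Lau K) : gX K * iota K p = iota K (sx K p) * gX K := by
  induction p using AddMonoidAlgebra.induction_linear with
  | zero => simp
  | add f g hf hg => simp only [map_add, mul_add, add_mul, hf, hg]
  | single m c =>
    obtain ⟨i, j⟩ := m
    rw [sx_single, iota_single, iota_single, gX, MonoidAlgebra.of_apply,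
      MonoidAlgebra.single_mul_single, MonoidAlgebra.single_mul_single, x_mul_nu, one_mul, mul_one]

theorem gY_mul_iota (p : Lau K) : gY K * iota K p = iota K (sy K p) * gY K := by
  induction p using AddMonoidAlgebra.induction_linear with
  | zero => simp
  | add f g hf hg => simp only [map_add, mul_add, add_mul, hf, hg]
  | single m c =>
    obtain ⟨i, j⟩ := m
    rw [sy_single, iota_single, iota_single, gY, MonoidAlgebra.of_apply,
      MonoidAlgebra.single_mul_single, MonoidAlgebra.single_mul_single, y_mul_nu, one_mul, mul_one]

theorem gX_mul_gX : gX K * gX K = iota K (va K) := by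
  rw [va, iota_single, gX, ← map_mul, nu_apply, MonoidAlgebra.of_apply, ← pow_two]
  simp

theorem gY_mul_gY : gY K * gY K = iota K (vb K) := by
  rw [vb, iota_single, gY, ← map_mul, nu_apply, MonoidAlgebra.of_apply, ← pow_two]
  simp

/-- `KΓ` is a left module over the ring of Laurent polynomials. -/
noncomputable instance lauModule : Module (Lau K) (MonoidAlgebra K Gam) :=
  Module.compHom _ (iota K : Lau K →+* MonoidAlgebra K Gam)

theorem lau_smul_def (p : Lau K) (z : MonoidAlgebra K Gam) : p • z = iota K p * z := rfl

theorem lau_smul_mul (p : Lau K) (z w : MonoidAlgebra K Gam) : p • z * w = p • (z * w) :=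
  mul_assoc _ _ _

theorem gX_mul_smul (p : Lau K) (z : MonoidAlgebra K Gam) :
    gX K * (p • z) = sx K p • (gX K * z) := by
  rw [lau_smul_def, lau_smul_def, ← mul_assoc, gX_mul_iota, mul_assoc]

theorem gY_mul_smul (p : Lau K) (z : MonoidAlgebra K Gam) :
    gY K * (p • z) = sy K p • (gY K * z) := by
  rw [lau_smul_def, lau_smul_def, ← mul_assoc, gY_mul_iota, mul_assoc]

theorem gX_mul_gX_smul : gX K * gX K = va K • 1 := by rw [gX_mul_gX, lau_smul_def, mul_one]

theorem gY_mul_gY_smul : gY K * gY K = vb K • 1 := by rw [gY_mul_gY, lau_smul_def, mul_one]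

/-- The elements of `KN` that are invariant under `x` and `y` are central. -/
theorem smul_mul_comm {n : Lau K} (hx : sx K n = n) (hy : sy K n = n) (z w : MonoidAlgebra K Gam) :
    z * (n • w) = n • (z * w) := by
  have key : ∀ g : Gam, Commute (iota K n) (MonoidAlgebra.of K Gam g) := by
    intro g
    have hg : g ∈ Subgroup.closure (Set.range gen) := by rw [closure_gen]; trivial
    have hl : ∀ l, Commute (iota K n) (MonoidAlgebra.of K Gam (gen l)) := by
      rintro (_ | _)
      · have := gX_mul_iota n
        rw [hx] at this; exact this.symm
      · have := gY_mul_iota n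
        rw [hy] at this; exact this.symm
    induction hg using Subgroup.closure_induction with
    | mem g hg => obtain ⟨l, rfl⟩ := hg; exact hl l
    | one => rw [map_one]; exact Commute.one_right _
    | mul g h _ _ ihg ihh => rw [map_mul]; exact ihg.mul_right ihh
    | inv g _ ih =>
      have h1 : MonoidAlgebra.of K Gam g⁻¹ * MonoidAlgebra.of K Gam g = 1 := by
        rw [← map_mul, inv_mul_cancel, map_one]
      have h2 : MonoidAlgebra.of K Gam g * MonoidAlgebra.of K Gam g⁻¹ = 1 := by
        rw [← map_mul, mul_inv_cancel, map_one]
      exact Commute.units_inv_right (u := ⟨_, _, h2, h1⟩) ih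
  have hz : Commute (iota K n) z := by
    induction z using MonoidAlgebra.induction_linear with
    | zero => exact Commute.zero_right _
    | add f g hf hg => exact hf.add_right hg
    | single g c =>
      have : MonoidAlgebra.single g c = c • MonoidAlgebra.of K Gam g := by
        simp [MonoidAlgebra.smul_single]
      rw [this]
      exact (key g).smul_right c
  rw [lau_smul_def, lau_smul_def, ← mul_assoc, ← mul_assoc, hz.eq]

end GroupAlgebra

/-! ### Coordinates with respect to the alternating words. -/

section Action

variable (K : Type*) [Field K]

/-- The coefficient of `x w` for the alternating word `w` at position `j`. -/
noncomputable def cx (j : ℤ) : Lau K := if 1 ≤ j then va K else 1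

/-- The coefficient of `y w` for the alternating word `w` at position `j`. -/
noncomputable def cy (j : ℤ) : Lau K := if j ≤ -1 then vb K else 1

variable {K}

theorem cx_ne_zero (j : ℤ) : cx K j ≠ 0 := by
  unfold cx; split_ifs; exacts [va_ne_zero, one_ne_zero]

theorem cy_ne_zero (j : ℤ) : cy K j ≠ 0 := by
  unfold cy; split_ifs; exacts [vb_ne_zero, one_ne_zero]

/-- Exactly one of `j` and `1 - j` is at least `1`, so of two consecutive multiplications by `x`
exactly one cancels a letter and contributes `a`. -/
theorem cx_mul (j : ℤ) : cx K (1 - j) * sx K (cx K j) = va K := by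
  unfold cx
  rcases le_or_gt 1 j with h | h
  · rw [if_neg (by omega), if_pos h]; simp
  · rw [if_pos (by omega), if_neg (by omega)]; simp

theorem cy_mul (j : ℤ) : cy K (-1 - j) * sy K (cy K j) = vb K := by
  unfold cy
  rcases le_or_gt j (-1) with h | h
  · rw [if_neg (by omega), if_pos h]; simp
  · rw [if_pos (by omega), if_neg (by omega)]; simp

variable (K) in
/-- Left multiplication by `x`, in coordinates with respect to the alternating words: the word
that `act` sends to `j` sits at position `j`. -/
noncomputable def opX : Module.End K (ℤ → Lau K) where
  toFun v k := cx K (1 - k) * sx K (v (1 - k))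
  map_add' v w := by ext1 k; simp [mul_add]
  map_smul' c v := by
    ext1 k
    have : sx K (c • v (1 - k)) = c • sx K (v (1 - k)) := by
      simp only [sx]; exact map_smul (AddMonoidAlgebra.domCongr K K _) c _
    simp [this]

variable (K) in
/-- Left multiplication by `y`, in coordinates with respect to the alternating words. -/
noncomputable def opY : Module.End K (ℤ → Lau K) where
  toFun v k := cy K (-1 - k) * sy K (v (-1 - k))
  map_add' v w := by ext1 k; simp [mul_add]
  map_smul' c v := by
    ext1 k
    have : sy K (c • v (-1 - k)) = c • sy K (v (-1 - k)) := by
      simp only [sy]; exact map_smul (AddMonoidAlgebra.domCongr K K _) c _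
    simp [this]

theorem opX_apply (v : ℤ → Lau K) (k : ℤ) : opX K v k = cx K (1 - k) * sx K (v (1 - k)) := rfl

theorem opY_apply (v : ℤ → Lau K) (k : ℤ) : opY K v k = cy K (-1 - k) * sy K (v (-1 - k)) := rfl

variable (K) in
/-- Multiplication by a Laurent polynomial in coordinates. -/
noncomputable def opMul : Lau K →* Module.End K (ℤ → Lau K) where
  toFun p := { toFun := fun v => p • v, map_add' := smul_add p, map_smul' := fun c v => by
                ext1 k; simp }
  map_one' := by ext1 v; simp
  map_mul' p q := by ext1 v; exact mul_smul p q v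

theorem opMul_apply (p : Lau K) (v : ℤ → Lau K) (k : ℤ) : opMul K p v k = p * v k := rfl

theorem opX_mul_opX : opX K * opX K = opMul K (va K) := by
  ext1 v; ext1 k
  rw [Module.End.mul_apply, opX_apply, opX_apply, opMul_apply, map_mul, sx_sx, ← mul_assoc,
    show (1 - (1 - k)) = k by ring, cx_mul]

theorem opY_mul_opY : opY K * opY K = opMul K (vb K) := by
  ext1 v; ext1 k
  rw [Module.End.mul_apply, opY_apply, opY_apply, opMul_apply, map_mul, sy_sy, ← mul_assoc,
    show (-1 - (-1 - k)) = k by ring, cy_mul]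

theorem opX_mul_opMul (p : Lau K) : opX K * opMul K p = opMul K (sx K p) * opX K := by
  ext1 v; ext1 k
  simp only [Module.End.mul_apply, opX_apply, opMul_apply, map_mul]
  ring

theorem opY_mul_opMul (p : Lau K) : opY K * opMul K p = opMul K (sy K p) * opY K := by
  ext1 v; ext1 k
  simp only [Module.End.mul_apply, opY_apply, opMul_apply, map_mul]
  ring

variable (K) in
/-- `opX` and `opY` are invertible. -/
noncomputable def opUnit : Letter → (Module.End K (ℤ → Lau K))ˣ
  | Letter.x => ⟨opX K, opX K * opMul K (vai K),
      by rw [← mul_assoc, opX_mul_opX, ← map_mul, va_mul_vai, map_one],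
      by rw [opX_mul_opMul, mul_assoc, opX_mul_opX, ← map_mul, sx_vai, mul_comm, va_mul_vai, map_one]⟩
  | Letter.y => ⟨opY K, opY K * opMul K (vbi K),
      by rw [← mul_assoc, opY_mul_opY, ← map_mul, vb_mul_vbi, map_one],
      by rw [opY_mul_opMul, mul_assoc, opY_mul_opY, ← map_mul, sy_vbi, mul_comm, vb_mul_vbi, map_one]⟩

variable (K) in
/-- The action of `Γ` on coordinates. -/
noncomputable def actUnit : Gam →* (Module.End K (ℤ → Lau K))ˣ :=
  PresentedGroup.toGroup (f := opUnit K) (rels := relators) (by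
    have hx : ((opUnit K Letter.x ^ 2 : (Module.End K (ℤ → Lau K))ˣ) : Module.End K _) =
        opMul K (va K) := by
      rw [Units.val_pow_eq_pow_val, pow_two]; exact opX_mul_opX
    have hy : ((opUnit K Letter.y ^ 2 : (Module.End K (ℤ → Lau K))ˣ) : Module.End K _) =
        opMul K (vb K) := by
      rw [Units.val_pow_eq_pow_val, pow_two]; exact opY_mul_opY
    rintro r (rfl | rfl)
    · simp only [map_mul, map_inv, map_pow, FreeGroup.lift_apply_of, inv_inv]
      rw [mul_assoc, mul_assoc, inv_mul_eq_one]
      ext1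
      rw [Units.val_mul, Units.val_mul, hx]
      -- The first relator in the form `y = x² y x²`.
      change opY K = opMul K (va K) * (opY K * opMul K (va K))
      rw [opY_mul_opMul, ← mul_assoc, ← map_mul, sy_va, va_mul_vai, map_one, one_mul]
    · simp only [map_mul, map_inv, map_pow, FreeGroup.lift_apply_of, inv_inv]
      rw [mul_assoc, mul_assoc, inv_mul_eq_one]
      ext1
      rw [Units.val_mul, Units.val_mul, hy]
      change opX K = opMul K (vb K) * (opX K * opMul K (vb K))
      rw [opX_mul_opMul, ← mul_assoc, ← map_mul, sx_vb, vb_mul_vbi, map_one, one_mul])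

theorem actUnit_gen (l : Letter) : actUnit K (gen l) = opUnit K l := PresentedGroup.toGroup.of _

variable (K) in
/-- The representation of `KΓ` on coordinates. -/
noncomputable def rep : MonoidAlgebra K Gam →ₐ[K] Module.End K (ℤ → Lau K) :=
  MonoidAlgebra.lift K _ _ ((Units.coeHom _).comp (actUnit K))

theorem rep_single (g : Gam) (c : K) : rep K (MonoidAlgebra.single g c) =
    c • (actUnit K g : Module.End K (ℤ → Lau K)) := by
  simp [rep, MonoidAlgebra.lift_single]

theorem rep_gX : rep K (gX K) = opX K := by
  rw [gX, MonoidAlgebra.of_apply, rep_single, actUnit_gen, one_smul]; rfl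

theorem rep_gY : rep K (gY K) = opY K := by
  rw [gY, MonoidAlgebra.of_apply, rep_single, actUnit_gen, one_smul]; rfl

/-- Both sides are homomorphisms in the exponent `m`, so it suffices to compare them at `(1, 0)` and
`(0, 1)`. -/
theorem rep_iota_single_one (m : ℤ × ℤ) :
    rep K (iota K (AddMonoidAlgebra.single m 1)) = opMul K (AddMonoidAlgebra.single m 1) := by
  let f : Multiplicative (ℤ × ℤ) →* (Module.End K (ℤ → Lau K))ˣ := (actUnit K).comp nu
  let g : Multiplicative (ℤ × ℤ) →* (Module.End K (ℤ → Lau K))ˣ :=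
    ((opMul K).comp (AddMonoidAlgebra.of K (ℤ × ℤ))).toHomUnits
  have h1 : f (Multiplicative.ofAdd (1, 0)) = g (Multiplicative.ofAdd (1, 0)) := by
    ext1
    have : f (Multiplicative.ofAdd (1, 0)) = opUnit K Letter.x * opUnit K Letter.x := by
      simp only [f, MonoidHom.comp_apply, nu_apply]
      rw [zpow_one, zpow_zero, mul_one, pow_two, map_mul, actUnit_gen]
    rw [this]
    exact opX_mul_opX
  have h2 : f (Multiplicative.ofAdd (0, 1)) = g (Multiplicative.ofAdd (0, 1)) := by
    ext1
    have : f (Multiplicative.ofAdd (0, 1)) = opUnit K Letter.y * opUnit K Letter.y := by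
      simp only [f, MonoidHom.comp_apply, nu_apply]
      rw [zpow_one, zpow_zero, one_mul, pow_two, map_mul, actUnit_gen]
    rw [this]
    exact opY_mul_opY
  have h3 : Multiplicative.ofAdd m =
      Multiplicative.ofAdd ((1, 0) : ℤ × ℤ) ^ m.1 * Multiplicative.ofAdd ((0, 1) : ℤ × ℤ) ^ m.2 := by
    rw [← ofAdd_zsmul, ← ofAdd_zsmul, ← ofAdd_add]
    simp
  have h4 : f (Multiplicative.ofAdd m) = g (Multiplicative.ofAdd m) := by
    rw [h3, map_mul, map_mul, map_zpow, map_zpow, map_zpow, map_zpow, h1, h2]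
  rw [iota_single, rep_single, one_smul]
  exact congrArg Units.val h4

theorem rep_iota (p : Lau K) (v : ℤ → Lau K) (k : ℤ) : rep K (iota K p) v k = p * v k := by
  induction p using AddMonoidAlgebra.induction_linear with
  | zero => simp
  | add f g hf hg => simp only [map_add, LinearMap.add_apply, Pi.add_apply, hf, hg, add_mul]
  | single m c =>
    have : (AddMonoidAlgebra.single m c : Lau K) = c • AddMonoidAlgebra.single m 1 := by
      simp [AddMonoidAlgebra.smul_single]
    rw [this, map_smul, map_smul, rep_iota_single_one, LinearMap.smul_apply, Pi.smul_apply,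
      opMul_apply, smul_mul_assoc]

theorem rep_smul (p : Lau K) (z : MonoidAlgebra K Gam) (v : ℤ → Lau K) (k : ℤ) :
    rep K (p • z) v k = p * rep K z v k := by
  rw [lau_smul_def, map_mul, Module.End.mul_apply, rep_iota]

/-- The coordinates of elements of `KΓ` vanish almost everywhere. -/
theorem finite_support_rep (z : MonoidAlgebra K Gam) {v : ℤ → Lau K}
    (hv : (Function.support v).Finite) : (Function.support (rep K z v)).Finite := by
  have hX : ∀ w : ℤ → Lau K, (Function.support w).Finite → (Function.support (opX K w)).Finite := by
    intro w hw
    refine (hw.preimage (f := fun k => 1 - k) (by intro i _ j _ h; simpa using h)).subset ?_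
    intro k hk h0
    exact hk (by rw [opX_apply]; simp [h0])
  have hY : ∀ w : ℤ → Lau K, (Function.support w).Finite → (Function.support (opY K w)).Finite := by
    intro w hw
    refine (hw.preimage (f := fun k => -1 - k) (by intro i _ j _ h; simpa using h)).subset ?_
    intro k hk h0
    exact hk (by rw [opY_apply]; simp [h0])
  have hM : ∀ (p : Lau K) (w : ℤ → Lau K), (Function.support w).Finite →
      (Function.support (opMul K p w)).Finite := by
    intro p w hw
    refine hw.subset fun k hk h0 => hk ?_
    rw [opMul_apply, h0, mul_zero]
  have hg : ∀ (g : Gam) (w : ℤ → Lau K), (Function.support w).Finite →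
      (Function.support ((actUnit K g : Module.End K (ℤ → Lau K)) w)).Finite := by
    intro g
    have hg : g ∈ Subgroup.closure (Set.range gen) := by rw [closure_gen]; trivial
    induction hg using Subgroup.closure_induction'' with
    | mem g hg =>
      obtain ⟨l, rfl⟩ := hg
      rw [actUnit_gen]
      cases l
      exacts [hX, hY]
    | inv_mem g hg =>
      obtain ⟨l, rfl⟩ := hg
      rw [map_inv, actUnit_gen]
      cases l
      exacts [fun w hw => hX _ (hM _ _ hw), fun w hw => hY _ (hM _ _ hw)]
    | one => simp
    | mul g h _ _ ihg ihh =>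
      intro w hw
      rw [map_mul, Units.val_mul, Module.End.mul_apply]
      exact ihg _ (ihh _ hw)
  induction z using MonoidAlgebra.induction_linear with
  | zero => simp
  | add f g hf hg =>
    rw [map_add, LinearMap.add_apply]
    exact (hf.union hg).subset (Function.support_add _ _)
  | single g c =>
    rw [rep_single, LinearMap.smul_apply]
    exact (hg g v hv).subset (Function.support_const_smul_subset c _)

/-- The coordinates of an element of `KΓ`. -/
noncomputable def coord (z : MonoidAlgebra K Gam) : ℤ → Lau K := rep K z (Pi.single 0 1)

theorem finite_support_coord (z : MonoidAlgebra K Gam) : (Function.support (coord z)).Finite :=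
  finite_support_rep z ((Set.finite_singleton 0).subset Pi.support_single_subset)

theorem coord_smul (p : Lau K) (z : MonoidAlgebra K Gam) (k : ℤ) :
    coord (p • z) k = p * coord z k := rep_smul _ _ _ _

theorem coord_mul (z w : MonoidAlgebra K Gam) : coord (z * w) = rep K z (coord w) := by
  rw [coord, map_mul]; rfl

theorem coord_iota (p : Lau K) (k : ℤ) : coord (iota K p) k = if k = 0 then p else 0 := by
  rw [coord, rep_iota, Pi.single_apply]
  split_ifs <;> simp

end Action

/-! ### Elements of length at most three and right regularity. -/

section ShortElements

variable {K : Type*} [Field K]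

/-- The general element of `KΓ` of length at most `3`. -/
noncomputable def short (p₀ p₁ q₁ p₂ q₂ p₃ q₃ : Lau K) : MonoidAlgebra K Gam :=
  p₀ • 1 + p₁ • gX K + q₁ • gY K + p₂ • (gX K * gY K) + q₂ • (gY K * gX K) +
    p₃ • (gX K * (gY K * gX K)) + q₃ • (gY K * (gX K * gY K))

theorem rep_short (p₀ p₁ q₁ p₂ q₂ p₃ q₃ : Lau K) (v : ℤ → Lau K) (k : ℤ) :
    rep K (short p₀ p₁ q₁ p₂ q₂ p₃ q₃) v k = p₀ * v k + p₁ * opX K v k + q₁ * opY K v k +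
      p₂ * opX K (opY K v) k + q₂ * opY K (opX K v) k + p₃ * opX K (opY K (opX K v)) k +
      q₃ * opY K (opX K (opY K v)) k := by
  simp only [short, map_add, LinearMap.add_apply, Pi.add_apply, rep_smul, map_mul, map_one,
    rep_gX, rep_gY, Module.End.mul_apply, Module.End.one_apply]

theorem coord_short (p₀ p₁ q₁ p₂ q₂ p₃ q₃ : Lau K) :
    coord (short p₀ p₁ q₁ p₂ q₂ p₃ q₃) 0 = p₀ ∧ coord (short p₀ p₁ q₁ p₂ q₂ p₃ q₃) 1 = p₁ ∧
    coord (short p₀ p₁ q₁ p₂ q₂ p₃ q₃) (-1) = q₁ ∧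
    coord (short p₀ p₁ q₁ p₂ q₂ p₃ q₃) 2 = p₂ := by
  refine ⟨?_, ?_, ?_, ?_⟩ <;>
  · rw [coord, rep_short]
    simp [opX_apply, opY_apply, cx, cy]

/-- An element that has a right multiple which is a non-zero element of `KN`. -/
def IsRightRegular (σ : MonoidAlgebra K Gam) : Prop :=
  ∃ (τ : MonoidAlgebra K Gam) (N : Lau K), N ≠ 0 ∧ σ * τ = N • 1

theorem exists_top_position {v : ℤ → Lau K} (hv : v ≠ 0) (hf : (Function.support v).Finite) :
    ∃ m : ℤ, 0 ≤ m ∧ (v m ≠ 0 ∨ v (-m) ≠ 0) ∧ ∀ j, m < j ∨ j < -m → v j = 0 := by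
  have hs : hf.toFinset.Nonempty := by
    rw [Set.Finite.toFinset_nonempty, Function.support_nonempty_iff]; exact hv
  obtain ⟨m, hm, h⟩ := Finset.exists_max_image hf.toFinset (fun j => |j|) hs
  rw [Set.Finite.mem_toFinset, Function.mem_support] at hm
  refine ⟨|m|, abs_nonneg m, ?_, fun j hj => ?_⟩
  · rcases abs_choice m with h | h <;> rw [h]
    · exact Or.inl hm
    · rw [neg_neg]; exact Or.inr hm
  · by_contra h0
    exact absurd (h j (by simpa using h0)) (not_le.2 (by rw [lt_abs]; omega))

/-- The vector is that of the right cofactor; since the product lies in `KN`, only position `0`,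
that of the empty word, survives. -/
theorem IsRightRegular.exists_coord {σ : MonoidAlgebra K Gam} (h : IsRightRegular σ) :
    ∃ (v : ℤ → Lau K) (m : ℤ), 0 ≤ m ∧ (v m ≠ 0 ∨ v (-m) ≠ 0) ∧ (∀ j, m < j ∨ j < -m → v j = 0) ∧
      ∀ k, k ≠ 0 → rep K σ v k = 0 := by
  obtain ⟨τ, N, hN, h⟩ := h
  have hc : ∀ k, rep K σ (coord τ) k = if k = 0 then N else 0 := by
    intro k
    rw [← coord_mul, h, lau_smul_def, mul_one, coord_iota]
  have hv : coord τ ≠ 0 := by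
    intro h0
    have := hc 0
    rw [h0, map_zero, if_pos rfl] at this
    exact hN this.symm
  obtain ⟨m, hm, h1, h2⟩ := exists_top_position hv (finite_support_coord τ)
  exact ⟨coord τ, m, hm, h1, h2, fun k hk => by rw [hc, if_neg hk]⟩

/-- Only one of the two alternating words of length `3` occurs in a right regular element of
length at most `3`. -/
theorem IsRightRegular.leading_three {p₀ p₁ q₁ p₂ q₂ p₃ q₃ : Lau K}
    (h : IsRightRegular (short p₀ p₁ q₁ p₂ q₂ p₃ q₃)) : p₃ = 0 ∨ q₃ = 0 := by
  obtain ⟨v, m, hm, hv, hz, hk⟩ := h.exists_coord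
  rcases hv with hv | hv
  · right
    -- Left multiplication by `x` and `y` moves position `j` to `1 - j` and `-1 - j`. A word at
    -- position `m` is empty or starts with `x`, so `yxy` takes it to `-m - 3`, which no other
    -- summand reaches.
    have := hk (-m - 3) (by omega)
    rw [rep_short] at this
    simp only [opX_apply, opY_apply] at this
    rw [hz (-m - 3) (by omega), hz (1 - (-m - 3)) (by omega), hz (-1 - (-m - 3)) (by omega),
      hz (-1 - (1 - (-m - 3))) (by omega), hz (1 - (-1 - (-m - 3))) (by omega),
      hz (1 - (-1 - (1 - (-m - 3)))) (by omega),
      show -1 - (1 - (-1 - (-m - 3))) = m by ring] at this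
    simpa [cx_ne_zero, cy_ne_zero, hv] using this
  · left
    -- Likewise `xyx` alone reaches `m + 3`, starting from `-m`.
    have := hk (m + 3) (by omega)
    rw [rep_short] at this
    simp only [opX_apply, opY_apply] at this
    rw [hz (m + 3) (by omega), hz (1 - (m + 3)) (by omega), hz (-1 - (m + 3)) (by omega),
      hz (-1 - (1 - (m + 3))) (by omega), hz (1 - (-1 - (m + 3))) (by omega),
      hz (-1 - (1 - (-1 - (m + 3)))) (by omega),
      show 1 - (-1 - (1 - (m + 3))) = -m by ring] at this
    simpa [cx_ne_zero, cy_ne_zero, hv] using this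

theorem IsRightRegular.leading_two {p₀ p₁ q₁ p₂ q₂ : Lau K}
    (h : IsRightRegular (short p₀ p₁ q₁ p₂ q₂ 0 0)) : p₂ = 0 ∨ q₂ = 0 := by
  obtain ⟨v, m, hm, hv, hz, hk⟩ := h.exists_coord
  rcases hv with hv | hv
  · left
    have := hk (m + 2) (by omega)
    rw [rep_short] at this
    simp only [opX_apply, opY_apply, zero_mul] at this
    rw [hz (m + 2) (by omega), hz (1 - (m + 2)) (by omega), hz (-1 - (m + 2)) (by omega),
      hz (1 - (-1 - (m + 2))) (by omega), show -1 - (1 - (m + 2)) = m by ring] at this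
    simpa [cx_ne_zero, cy_ne_zero, hv] using this
  · right
    have := hk (-m - 2) (by omega)
    rw [rep_short] at this
    simp only [opX_apply, opY_apply, zero_mul] at this
    rw [hz (-m - 2) (by omega), hz (1 - (-m - 2)) (by omega), hz (-1 - (-m - 2)) (by omega),
      hz (-1 - (1 - (-m - 2))) (by omega), show 1 - (-1 - (-m - 2)) = -m by ring] at this
    simpa [cx_ne_zero, cy_ne_zero, hv] using this

theorem IsRightRegular.leading_one {p₀ p₁ q₁ : Lau K}
    (h : IsRightRegular (short p₀ p₁ q₁ 0 0 0 0)) : p₁ = 0 ∨ q₁ = 0 := by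
  obtain ⟨v, m, hm, hv, hz, hk⟩ := h.exists_coord
  rcases hv with hv | hv
  · right
    have := hk (-m - 1) (by omega)
    rw [rep_short] at this
    simp only [opX_apply, opY_apply, zero_mul] at this
    rw [hz (-m - 1) (by omega), hz (1 - (-m - 1)) (by omega),
      show -1 - (-m - 1) = m by ring] at this
    simpa [cx_ne_zero, cy_ne_zero, hv] using this
  · left
    have := hk (m + 1) (by omega)
    rw [rep_short] at this
    simp only [opX_apply, opY_apply, zero_mul] at this
    rw [hz (m + 1) (by omega), hz (-1 - (m + 1)) (by omega),
      show 1 - (m + 1) = -m by ring] at this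
    simpa [cx_ne_zero, cy_ne_zero, hv] using this

/-- Right regularity persists under multiplication by divisors of central elements. -/
theorem IsRightRegular.mul_right {σ z w : MonoidAlgebra K Gam} (h : IsRightRegular σ)
    {n : Lau K} (hn : n ≠ 0) (hx : sx K n = n) (hy : sy K n = n) (hzw : z * w = n • 1) :
    IsRightRegular (σ * z) := by
  obtain ⟨τ, N, hN, h⟩ := h
  refine ⟨w * τ, n * N, mul_ne_zero hn hN, ?_⟩
  rw [mul_assoc, ← mul_assoc z, hzw, lau_smul_mul, one_mul, smul_mul_comm hx hy, h, mul_smul]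

/-- The product of `s + t x` and `sx s - t x` is the norm, which is fixed by `sx`. Multiplying it by
its image under `sy` makes it central. -/
theorem IsRightRegular.mul_x {σ : MonoidAlgebra K Gam} (h : IsRightRegular σ) {s t : Lau K}
    (hst : s ≠ 0 ∨ t ≠ 0) : IsRightRegular (σ * (s • 1 + t • gX K)) := by
  have hn := normX_ne_zero hst
  refine h.mul_right (w := (sx K s • 1 - t • gX K) *
    (sy K (s * sx K s - va K * t * sx K t)) • 1)
    (n := (s * sx K s - va K * t * sx K t) * sy K (s * sx K s - va K * t * sx K t)) ?_ ?_ ?_ ?_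
  · exact mul_ne_zero hn (by rwa [Ne, sy_eq_zero])
  · simp only [map_sub, map_mul, sx_sx, sy_sx, sx_va, sy_va, sx_vai]; ring
  · simp only [map_sub, map_mul, sy_sy, sy_sx, sy_va, sy_vai]; ring
  · simp only [add_mul, mul_sub, sub_mul, lau_smul_mul, gX_mul_smul, mul_one, one_mul,
      gX_mul_gX_smul, map_sub, map_mul, sx_sx, sy_sx, sy_va, sx_vai]
    module

theorem IsRightRegular.mul_y {σ : MonoidAlgebra K Gam} (h : IsRightRegular σ) {s t : Lau K}
    (hst : s ≠ 0 ∨ t ≠ 0) : IsRightRegular (σ * (s • 1 + t • gY K)) := by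
  have hn := normY_ne_zero hst
  refine h.mul_right (w := (sy K s • 1 - t • gY K) *
    (sx K (s * sy K s - vb K * t * sy K t)) • 1)
    (n := (s * sy K s - vb K * t * sy K t) * sx K (s * sy K s - vb K * t * sy K t)) ?_ ?_ ?_ ?_
  · exact mul_ne_zero hn (by rwa [Ne, sx_eq_zero])
  · simp only [map_sub, map_mul, sx_sx, sx_vb, sx_vbi]; ring
  · simp only [map_sub, map_mul, sy_sy, sy_sx, sy_vb, sx_vb, sy_vbi]; ring
  · simp only [add_mul, mul_sub, sub_mul, lau_smul_mul, gY_mul_smul, mul_one, one_mul,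
      gY_mul_gY_smul, map_sub, map_mul, sy_sx, sy_sy, sx_vb, sy_vbi]
    module

theorem short_mul_x (p₀ p₁ q₁ p₂ q₂ p₃ s t : Lau K) :
    short p₀ p₁ q₁ p₂ q₂ p₃ 0 * (s • 1 + t • gX K) =
      short (p₀ * s + va K * p₁ * sx K t) (p₀ * t + p₁ * sx K s)
        (q₁ * sy K s + vai K * q₂ * sx K (sy K t))
        (p₂ * sx K (sy K s) + vai K * p₃ * sy K t)
        (q₁ * sy K t + q₂ * sx K (sy K s))
        (p₂ * sx K (sy K t) + p₃ * sy K s) 0 := by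
  simp only [short, mul_add, add_mul, lau_smul_mul, gX_mul_smul, gY_mul_smul, mul_one, one_mul,
    mul_assoc, gX_mul_gX_smul, sx_sx, sy_sx, sy_va, sx_vai]
  module

theorem short_mul_y (p₀ p₁ q₁ p₂ s t : Lau K) :
    short p₀ p₁ q₁ p₂ 0 0 0 * (s • 1 + t • gY K) =
      short (p₀ * s + vb K * q₁ * sy K t) (p₁ * sx K s + vbi K * p₂ * sx K (sy K t))
        (p₀ * t + q₁ * sy K s) (p₁ * sx K t + p₂ * sx K (sy K s)) 0 0 0 := by
  simp only [short, mul_add, add_mul, lau_smul_mul, gX_mul_smul, gY_mul_smul, mul_one, one_mul,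
    mul_assoc, gY_mul_gY_smul, sx_vb]
  module

end ShortElements

/-! ### Triviality of units in which `yxy` does not occur. -/

section Units

variable {K : Type*} [Field K]

theorem IsTrivialUnit.mul {σ τ : MonoidAlgebra K Gam} (hσ : IsTrivialUnit σ)
    (hτ : IsTrivialUnit τ) : IsTrivialUnit (σ * τ) := by
  obtain ⟨c, g, hc, rfl⟩ := hσ
  obtain ⟨d, h, hd, rfl⟩ := hτ
  exact ⟨c * d, g * h, mul_ne_zero hc hd, MonoidAlgebra.single_mul_single ..⟩

theorem IsTrivialUnit.isUnit {σ : MonoidAlgebra K Gam} (h : IsTrivialUnit σ) : IsUnit σ := by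
  obtain ⟨c, g, hc, rfl⟩ := h
  refine isUnit_iff_exists.2 ⟨MonoidAlgebra.single g⁻¹ c⁻¹, ?_, ?_⟩ <;>
  rw [MonoidAlgebra.single_mul_single, MonoidAlgebra.one_def] <;> simp [hc]

theorem isTrivialUnit_gX : IsTrivialUnit (gX K) := ⟨1, _, one_ne_zero, rfl⟩

theorem isTrivialUnit_gY : IsTrivialUnit (gY K) := ⟨1, _, one_ne_zero, rfl⟩

theorem isTrivialUnit_smul {p : Lau K} (hp : IsUnit p) {σ : MonoidAlgebra K Gam}
    (hσ : IsTrivialUnit σ) : IsTrivialUnit (p • σ) := by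
  obtain ⟨m, c, hc, rfl⟩ := exists_single_of_isUnit hp
  rw [lau_smul_def]
  exact IsTrivialUnit.mul ⟨c, _, hc, iota_single m c⟩ hσ

/-- The right invertible elements of the group algebra of `⟨N, x⟩` are trivial units. -/
theorem isTrivialUnit_of_mul_eq_one {p q : Lau K} {τ : MonoidAlgebra K Gam}
    (h : (p • 1 + q • gX K) * τ = 1) : IsTrivialUnit (p • 1 + q • gX K) := by
  have hk : ∀ k, p * coord τ k + q * (cx K (1 - k) * sx K (coord τ (1 - k))) =
      if k = 0 then 1 else 0 := by
    intro k
    rw [← coord_iota 1 k, map_one, ← h, coord_mul, map_add, LinearMap.add_apply, Pi.add_apply,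
      rep_smul, rep_smul, map_one, Module.End.one_apply, rep_gX, opX_apply]
  -- Positions `0` and `1` are the words `1` and `x`, so these two equations stay inside the group
  -- algebra of `⟨N, x⟩`.
  have h0 := hk 0
  have h1 := hk 1
  rw [if_pos rfl, sub_zero, cx, if_pos le_rfl] at h0
  rw [if_neg one_ne_zero, sub_self, cx, if_neg (by norm_num), one_mul] at h1
  have h0' := congrArg (sx K) h0
  simp only [map_add, map_mul, sx_sx, sx_va, map_one] at h0'
  -- The norm is multiplicative: the norm of the part of `τ` in `KN + KN x` is the inverse.
  have hn : IsUnit (p * sx K p - va K * q * sx K q) := by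
    refine IsUnit.of_mul_eq_one
      (coord τ 0 * sx K (coord τ 0) - va K * coord τ 1 * sx K (coord τ 1)) ?_
    linear_combination
      (sx K p * sx K (coord τ 0) + sx K q * (va K * coord τ 1)) * h0 + h0' -
        va K * (sx K p * sx K (coord τ 1) + sx K q * coord τ 0) * h1
  rcases eq_zero_or_eq_zero_of_isUnit_normX hn with rfl | rfl
  · rw [zero_smul, zero_add]
    rw [zero_mul, zero_add] at h0
    exact isTrivialUnit_smul (IsUnit.of_mul_eq_one _ h0) isTrivialUnit_gX
  · rw [zero_smul, add_zero]
    rw [zero_mul, add_zero] at h0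
    exact isTrivialUnit_smul (IsUnit.of_mul_eq_one _ h0) ⟨1, 1, one_ne_zero, rfl⟩

/-- The relation between the coefficients of the words that involve `y`. -/
theorem IsRightRegular.relation_three {p₀ p₁ q₁ p₂ q₂ p₃ : Lau K}
    (h : IsRightRegular (short p₀ p₁ q₁ p₂ q₂ p₃ 0)) : p₃ * sx K q₁ = p₂ * sx K q₂ := by
  by_cases h0 : p₂ ≠ 0 ∨ p₃ ≠ 0
  · have h' := h.mul_x (s := sy K p₂) (t := -sx K (sy K p₃)) (by simpa using h0)
    rw [short_mul_x] at h'
    simp only [map_neg, sy_sx, sy_sy, sx_sx] at h'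
    rw [show p₂ * -p₃ + p₃ * p₂ = 0 by ring] at h'
    -- The new coefficient of `xy` is the image under `sy` of a non-zero norm, so that of `yx` must
    -- vanish, which is the relation.
    rcases h'.leading_two with h1 | h1
    · have hn := normX_ne_zero (K := K) (p := sy K p₂) (q := sy K p₃) (by simpa using h0)
      refine absurd ?_ hn
      rw [← sy_eq_zero]
      simp only [map_sub, map_mul, sy_sx, sy_sy, sy_va]
      linear_combination h1
    · have h2 := congrArg (sx K) h1
      simp only [map_add, map_mul, map_neg, sx_sx, map_zero] at h2
      linear_combination -h2
  · push Not at h0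
    rw [h0.1, h0.2]; ring

/-- The same device with a factor in `y`: it cancels `xy`, the coefficient of `x` becomes a
conjugate of a non-zero norm, and so that of `y` vanishes. -/
theorem IsRightRegular.relation_two {p₀ p₁ q₁ p₂ : Lau K}
    (h : IsRightRegular (short p₀ p₁ q₁ p₂ 0 0 0)) : q₁ * sx K p₁ = p₀ * sx K p₂ := by
  by_cases h0 : p₁ ≠ 0 ∨ p₂ ≠ 0
  · have h' := h.mul_y (s := sx K (sy K p₁)) (t := -sx K p₂) (by simpa using h0)
    rw [short_mul_y] at h'
    simp only [map_neg, sy_sx, sy_sy, sx_sx] at h'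
    rw [show p₁ * -p₂ + p₂ * p₁ = 0 by ring] at h'
    rcases h'.leading_one with h1 | h1
    · have hn := normY_ne_zero (K := K) (p := sx K p₁) (q := sx K p₂) (by simpa using h0)
      refine absurd ?_ hn
      rw [← sx_eq_zero]
      simp only [map_sub, map_mul, sy_sx, sx_sx, sx_vb]
      linear_combination h1
    · linear_combination h1
  · push Not at h0
    rw [h0.1, h0.2]; simp

/-- If the product of two primitive elements and the conjugate of a norm is a left multiple of
the central norm, then the norm is a unit. -/
theorem isUnit_normY_of_factorization {k l g c : Lau K} (hkl : IsRelPrime k l)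
    (hgc : IsRelPrime g c) {σ : MonoidAlgebra K Gam}
    (h : (sy K k • 1 + (-sx K (sy K l)) • gX K) * (sy K g • 1 + (-c) • gY K) *
      (sx K (g * sy K g - vb K * c * sy K c) • 1) =
      ((g * sy K g - vb K * c * sy K c) * sx K (g * sy K g - vb K * c * sy K c)) • σ) :
    IsUnit (g * sy K g - vb K * c * sy K c) := by
  set κ := g * sy K g - vb K * c * sy K c with hκ
  have hκy : sy K κ = κ := by
    simp only [hκ, map_sub, map_mul, sy_sy, sy_vb]; ring
  have hκ0 : κ ≠ 0 := by
    refine normY_ne_zero ?_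
    by_contra! h0
    rw [h0.1, h0.2] at hgc
    exact not_isUnit_zero (isRelPrime_zero_left.1 hgc)
  have hκx0 : sx K κ ≠ 0 := by rwa [Ne, sx_eq_zero]
  -- As `κ` is fixed by `sy`, the factor `sx κ` passes `y` unchanged and turns into `κ` on passing
  -- `x`. Each coordinate thus keeps one of the two factors of `κ sx(κ)`, and the other one yields a
  -- divisibility.
  have hL : (sy K k • 1 + (-sx K (sy K l)) • gX K) * (sy K g • 1 + (-c) • gY K) *
      (sx K κ • 1) = short (sy K k * sy K g * sx K κ) (-sx K (sy K l) * sx K (sy K g) * κ)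
        (-(sy K k * c * sx K κ)) (sx K (sy K l) * sx K c * κ) 0 0 0 := by
    simp only [short, add_mul, mul_add, lau_smul_mul, gX_mul_smul, gY_mul_smul, mul_one, one_mul,
      mul_assoc, sx_sx, sy_sx, hκy, map_neg]
    module
  rw [hL] at h
  obtain ⟨c0, c1, c2, c3⟩ := coord_short (sy K k * sy K g * sx K κ)
    (-sx K (sy K l) * sx K (sy K g) * κ) (-(sy K k * c * sx K κ)) (sx K (sy K l) * sx K c * κ) 0 0 0
  rw [h, coord_smul] at c0 c1 c2 c3
  have d0 : κ ∣ k * g := by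
    refine ⟨sy K (coord σ 0), ?_⟩
    have := mul_right_cancel₀ (b := sx K κ) hκx0
      (show κ * coord σ 0 * sx K κ = sy K k * sy K g * sx K κ by linear_combination c0)
    have := congrArg (sy K) this
    simp only [map_mul, sy_sy, hκy] at this
    exact this.symm
  have d1 : κ ∣ l * g := by
    refine ⟨-sy K (sx K (coord σ 1)), ?_⟩
    have := mul_right_cancel₀ (b := κ) hκ0
      (show sx K κ * coord σ 1 * κ = -sx K (sy K l) * sx K (sy K g) * κ by linear_combination c1)
    have := congrArg (fun z => sy K (sx K z)) this
    simp only [map_mul, map_neg, sx_sx, sy_sy, hκy] at this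
    linear_combination this
  have d2 : κ ∣ sy K k * c := by
    refine ⟨-coord σ (-1), ?_⟩
    have := mul_right_cancel₀ (b := sx K κ) hκx0
      (show κ * coord σ (-1) * sx K κ = -(sy K k * c) * sx K κ by linear_combination c2)
    linear_combination this
  have d3 : κ ∣ sy K l * c := by
    refine ⟨sx K (coord σ 2), ?_⟩
    have := mul_right_cancel₀ (b := κ) hκ0
      (show sx K κ * coord σ 2 * κ = sx K (sy K l) * sx K c * κ by linear_combination c3)
    have := congrArg (sx K) this
    simp only [map_mul, sx_sx] at this
    exact this.symm
  have hsy : ∀ {z : Lau K}, κ ∣ z → κ ∣ sy K z := fun hz => by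
    have := map_dvd (sy K) hz
    rwa [hκy] at this
  have e1 : κ ∣ g := dvd_of_dvd_mul_of_dvd_mul hkl d0 d1
  -- The coprime pair appears here conjugated by `y`, which is undone since `κ` is fixed by `sy`.
  have e2 : κ ∣ sy K c := by
    refine dvd_of_dvd_mul_of_dvd_mul hkl ?_ ?_
    · simpa using hsy d2
    · simpa using hsy d3
  have e3 : κ ∣ c := by simpa using hsy e2
  exact hgc e1 e3

/-- The right factor is the conjugate of `sx (sy k) + sx (sy l) x`, the common right factor of the
terms that involve `y`. Those terms therefore pick up a norm and lose `yx` and `xyx`. -/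
theorem short_mul_kernel (p₀ p₁ k l m n : Lau K) :
    short p₀ p₁ (sx K n * sx K k) (m * k) (sx K n * sx K l) (m * l) 0 *
        (sy K k • 1 + (-sx K (sy K l)) • gX K) =
      short (p₀ * sy K k - va K * p₁ * sy K l) (p₁ * sx K (sy K k) - p₀ * sx K (sy K l))
        (sx K n * (k * sx K k - vai K * l * sx K l)) (m * (k * sx K k - vai K * l * sx K l))
        0 0 0 := by
  rw [short_mul_x]
  simp only [map_neg, sy_sx, sy_sy, sx_sx]
  congr 1 <;> ring

/-- The short element is `(r + sx(s) x)(g + c y)`, multiplied here by the conjugate of its right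
factor. -/
theorem short_mul_kernel' (g c r s : Lau K) :
    short (r * g) (sx K s * sx K g) (r * c) (sx K s * sx K c) 0 0 0 *
        (sy K g • 1 + (-c) • gY K) =
      (r • 1 + sx K s • gX K) * ((g * sy K g - vb K * c * sy K c) • 1) := by
  rw [short_mul_y]
  simp only [short, add_mul, lau_smul_mul, gX_mul_smul, mul_one, one_mul, map_sub, map_mul,
    sx_vb, map_neg, sy_sy]
  module

theorem ne_zero_or_ne_zero_of_isRelPrime {k l : Lau K} (h : IsRelPrime k l) : k ≠ 0 ∨ l ≠ 0 := by
  by_contra! h0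
  rw [h0.1, h0.2] at h
  exact not_isUnit_zero (isRelPrime_zero_left.1 h)

/-- If a unit, multiplied by a primitive element of the group algebra of `⟨N, x⟩`, splits off a
primitive factor `g + c y` on the right, then the norm of this factor is a unit. -/
theorem isUnit_normY_of_isUnit {σ : MonoidAlgebra K Gam} (hσ : IsUnit σ) {k l g c r s : Lau K}
    (hkl : IsRelPrime k l) (hgc : IsRelPrime g c)
    (h : σ * (sy K k • 1 + (-sx K (sy K l)) • gX K) =
      short (r * g) (sx K s * sx K g) (r * c) (sx K s * sx K c) 0 0 0) :
    IsUnit (g * sy K g - vb K * c * sy K c) := by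
  obtain ⟨τ, -, hτσ⟩ := isUnit_iff_exists.1 hσ
  have hmul : σ * ((sy K k • 1 + (-sx K (sy K l)) • gX K) * (sy K g • 1 + (-c) • gY K)) =
      (r • 1 + sx K s • gX K) * ((g * sy K g - vb K * c * sy K c) • 1) := by
    rw [← mul_assoc, h, short_mul_kernel']
  refine isUnit_normY_of_factorization hkl hgc (σ := τ * (r • 1 + sx K s • gX K)) ?_
  have hκy : sy K (g * sy K g - vb K * c * sy K c) = g * sy K g - vb K * c * sy K c := by
    simp only [map_sub, map_mul, sy_sy, sy_vb]; ring
  generalize g * sy K g - vb K * c * sy K c = κ at hmul hκy ⊢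
  have hc : ∀ z w : MonoidAlgebra K Gam, z * ((κ * sx K κ) • w) = (κ * sx K κ) • (z * w) := by
    refine smul_mul_comm ?_ ?_
    · rw [map_mul, sx_sx, mul_comm]
    · rw [map_mul, sy_sx, hκy]
  -- The factor `sx κ` completes `κ` to a central element, which can be moved to the left past `τ`.
  have h5 : τ * (σ * ((sy K k • 1 + (-sx K (sy K l)) • gX K) * (sy K g • 1 + (-c) • gY K)) *
      (sx K κ • 1)) = τ * ((r • 1 + sx K s • gX K) * (κ • 1) * (sx K κ • 1)) := by rw [hmul]
  rwa [mul_assoc σ, ← mul_assoc τ, hτσ, one_mul, mul_assoc _ (κ • 1), lau_smul_mul, one_mul,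
    smul_smul, hc, hc, mul_one] at h5

/-- A unit that is a product of an element of the group algebra of `⟨N, x⟩`, the generator `y`,
and another element of the group algebra of `⟨N, x⟩` is trivial. -/
theorem isTrivialUnit_of_eq_mul {p q p' q' : Lau K}
    (h : IsUnit ((p • 1 + q • gX K) * gY K * (p' • 1 + q' • gX K))) :
    IsTrivialUnit ((p • 1 + q • gX K) * gY K * (p' • 1 + q' • gX K)) := by
  obtain ⟨τ, hτ⟩ := h.exists_right_inv
  have hM : IsTrivialUnit (p • 1 + q • gX K) := by
    -- A right inverse of the first factor is the rest of the product times `τ`; it need not lie in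
    -- the group algebra of `⟨N, x⟩`.
    refine isTrivialUnit_of_mul_eq_one (τ := gY K * (p' • 1 + q' • gX K) * τ) ?_
    rw [← mul_assoc, ← mul_assoc]
    exact hτ
  have hMY := hM.mul isTrivialUnit_gY
  obtain ⟨u, hu⟩ := hMY.isUnit
  have hE : IsUnit (p' • 1 + q' • gX K) := by
    rw [← hu] at h
    exact (Units.isUnit_units_mul u _).1 h
  obtain ⟨ρ, hρ⟩ := hE.exists_right_inv
  exact hMY.mul (isTrivialUnit_of_mul_eq_one hρ)

/-- A unit of length at most three in which the word `yxy` does not occur is trivial. -/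
theorem isTrivialUnit_short {p₀ p₁ q₁ p₂ q₂ p₃ : Lau K}
    (h : IsUnit (short p₀ p₁ q₁ p₂ q₂ p₃ 0)) : IsTrivialUnit (short p₀ p₁ q₁ p₂ q₂ p₃ 0) := by
  have hreg : IsRightRegular (short p₀ p₁ q₁ p₂ q₂ p₃ 0) := by
    obtain ⟨τ, hστ⟩ := h.exists_right_inv
    exact ⟨τ, 1, one_ne_zero, by rw [hστ, one_smul]⟩
  obtain ⟨k, l, m, n, hkl, rfl, rfl, hq₁, hq₂⟩ := exists_rankOne hreg.relation_three
  obtain rfl : q₁ = sx K n * sx K k := by rw [← map_mul, ← hq₁, sx_sx]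
  obtain rfl : q₂ = sx K n * sx K l := by rw [← map_mul, ← hq₂, sx_sx]
  have hkl0 := ne_zero_or_ne_zero_of_isRelPrime hkl
  have hreg2 := hreg.mul_x (s := sy K k) (t := -sx K (sy K l)) (by simpa using hkl0)
  have hn : sy K k * sx K (sy K k) - va K * sy K l * sx K (sy K l) ≠ 0 :=
    normX_ne_zero (by simpa using hkl0)
  have hν0 : k * sx K k - vai K * l * sx K l ≠ 0 := by
    rw [Ne, ← sy_eq_zero]
    simpa using hn
  have hmul := short_mul_kernel p₀ p₁ k l m n
  rw [hmul] at hreg2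
  obtain ⟨g, c, r, s, hgc, h1, h2, h3, h4⟩ := exists_rankOne hreg2.relation_two
  have h3' := congrArg (sx K) h3
  have h4' := congrArg (sx K) h4
  rw [sx_sx, map_mul] at h3' h4'
  have hκ : IsUnit (g * sy K g - vb K * c * sy K c) := by
    refine isUnit_normY_of_isUnit h hkl hgc (r := r) (s := s) ?_
    rw [hmul, h1, h2, h3', h4']
  rcases eq_zero_or_eq_zero_of_isUnit_normY hκ with rfl | rfl
  · rw [mul_zero] at h1
    rw [map_zero, mul_zero] at h3'
    -- With `g = 0` the coefficients of `1` and `x` vanish: a linear system in `p₀`, `p₁` whose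
    -- determinant is, up to sign, the non-zero norm `hn`.
    obtain rfl : p₀ = 0 := by
      refine (mul_eq_zero.1 (?_ : p₀ * _ = 0)).resolve_right hn
      linear_combination sx K (sy K k) * h1 + va K * sy K l * h3'
    obtain rfl : p₁ = 0 := by
      refine (mul_eq_zero.1 (?_ : p₁ * _ = 0)).resolve_right hn
      linear_combination sy K k * h3' + sx K (sy K l) * h1
    have hfac : short 0 0 (sx K n * sx K k) (m * k) (sx K n * sx K l) (m * l) 0 =
        (sx K n • 1 + m • gX K) * gY K * (sx K (sy K k) • 1 + sx K (sy K l) • gX K) := by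
      simp only [short, add_mul, mul_add, lau_smul_mul, gX_mul_smul, gY_mul_smul, mul_one, one_mul,
        mul_assoc, sx_sx, sy_sx, sy_sy]
      module
    rw [hfac] at h ⊢
    exact isTrivialUnit_of_eq_mul h
  · rw [mul_zero] at h2
    rw [map_zero, mul_zero] at h4'
    obtain rfl : n = 0 := by simpa [hν0] using h2
    obtain rfl : m = 0 := by simpa [hν0] using h4'
    obtain ⟨τ, hτ⟩ := h.exists_right_inv
    have hfac : short p₀ p₁ (sx K 0 * sx K k) (0 * k) (sx K 0 * sx K l) (0 * l) 0 =
        p₀ • 1 + p₁ • gX K := by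
      simp [short]
    rw [hfac] at hτ ⊢
    exact isTrivialUnit_of_mul_eq_one hτ

end Units

/-! ### Elements of length at most three in normal form. -/

section ShortForm

variable {K : Type*} [Field K]

theorem short_add (p₀ p₁ q₁ p₂ q₂ p₃ q₃ r₀ r₁ s₁ r₂ s₂ r₃ s₃ : Lau K) :
    short p₀ p₁ q₁ p₂ q₂ p₃ q₃ + short r₀ r₁ s₁ r₂ s₂ r₃ s₃ =
      short (p₀ + r₀) (p₁ + r₁) (q₁ + s₁) (p₂ + r₂) (q₂ + s₂) (p₃ + r₃) (q₃ + s₃) := by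
  simp only [short]
  module

theorem mul_eval_inv_word_mem (g : Gam) : g * (eval (word g).1)⁻¹ ∈ N :=
  (existsUnique_word g).choose_spec.1

theorem eval_eq_of_length_le (w : W) (hw : w.1.length ≤ 3) :
    MonoidAlgebra.of K Gam (eval w.1) ∈ ({1, gX K, gY K, gX K * gY K, gY K * gX K,
      gX K * (gY K * gX K), gY K * (gX K * gY K)} : Set (MonoidAlgebra K Gam)) := by
  obtain ⟨w, hc⟩ := w
  have e : ∀ l u, MonoidAlgebra.of K Gam (eval (l :: u)) =
      MonoidAlgebra.of K Gam (gen l) * MonoidAlgebra.of K Gam (eval u) := fun l u => by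
    rw [← map_mul]; simp [eval]
  have e0 : MonoidAlgebra.of K Gam (eval []) = 1 := map_one _
  have ex : MonoidAlgebra.of K Gam (gen Letter.x) = gX K := rfl
  have ey : MonoidAlgebra.of K Gam (gen Letter.y) = gY K := rfl
  match w, hc, hw with
  | [], _, _ => simp only [e0]; simp
  | [l], _, _ => cases l <;> simp only [e, e0, ex, ey, mul_one] <;> simp
  | [l, m], hc, _ =>
    cases l <;> cases m <;> simp only [e, e0, ex, ey, mul_one] <;> simp at hc ⊢
  | [l, m, n], hc, _ =>
    cases l <;> cases m <;> cases n <;> simp only [e, e0, ex, ey, mul_one] <;> simp at hc ⊢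
  | _ :: _ :: _ :: _ :: _, _, hw => simp at hw; omega

theorem exists_short_single {g : Gam} (hg : len g ≤ 3) (c : K) :
    ∃ p₀ p₁ q₁ p₂ q₂ p₃ q₃, MonoidAlgebra.single g c = short p₀ p₁ q₁ p₂ q₂ p₃ q₃ := by
  obtain ⟨m, hm⟩ := N_le_range_nu (mul_eval_inv_word_mem g)
  have h : MonoidAlgebra.single g c = (AddMonoidAlgebra.single m.toAdd c : Lau K) •
      MonoidAlgebra.of K Gam (eval (word g).1) := by
    rw [lau_smul_def, iota_single, ofAdd_toAdd, hm, MonoidAlgebra.of_apply,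
      MonoidAlgebra.single_mul_single, mul_one, inv_mul_cancel_right]
  rw [h]
  generalize (AddMonoidAlgebra.single m.toAdd c : Lau K) = p
  rcases eval_eq_of_length_le (K := K) (word g) hg with e | e | e | e | e | e | e <;> rw [e]
  · exact ⟨p, 0, 0, 0, 0, 0, 0, by simp [short]⟩
  · exact ⟨0, p, 0, 0, 0, 0, 0, by simp [short]⟩
  · exact ⟨0, 0, p, 0, 0, 0, 0, by simp [short]⟩
  · exact ⟨0, 0, 0, p, 0, 0, 0, by simp [short]⟩
  · exact ⟨0, 0, 0, 0, p, 0, 0, by simp [short]⟩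
  · exact ⟨0, 0, 0, 0, 0, p, 0, by simp [short]⟩
  · exact ⟨0, 0, 0, 0, 0, 0, p, by simp [short]⟩

/-- The elements of length at most `3` in terms of coordinates. -/
theorem exists_short_of_length_le {σ : MonoidAlgebra K Gam} (h : length σ ≤ 3) :
    ∃ p₀ p₁ q₁ p₂ q₂ p₃ q₃, σ = short p₀ p₁ q₁ p₂ q₂ p₃ q₃ := by
  have hlen : ∀ g ∈ σ.coeff.support, len g ≤ 3 := fun g hg => by
    have := (Finset.le_sup (f := fun g => (len g : WithBot ℕ)) hg).trans h
    exact_mod_cast this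
  rw [← MonoidAlgebra.sum_coeff_single σ]
  refine Finset.sum_induction _
    (fun τ => ∃ p₀ p₁ q₁ p₂ q₂ p₃ q₃, τ = short p₀ p₁ q₁ p₂ q₂ p₃ q₃) ?_ ?_ ?_
  · rintro _ _ ⟨p₀, p₁, q₁, p₂, q₂, p₃, q₃, rfl⟩ ⟨r₀, r₁, s₁, r₂, s₂, r₃, s₃, rfl⟩
    exact ⟨_, _, _, _, _, _, _, short_add ..⟩
  · exact ⟨0, 0, 0, 0, 0, 0, 0, by simp [short]⟩
  · exact fun g hg => exists_short_single (hlen g hg) _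

end ShortForm

/-! ### The symmetry between `x` and `y`, and the general case. -/

section Swap

/-- The interchange of the two letters. -/
def Letter.swap : Letter → Letter
  | Letter.x => Letter.y
  | Letter.y => Letter.x

/-- The automorphism of `Γ` that interchanges `x` and `y`. -/
def swapHom : Gam →* Gam :=
  PresentedGroup.toGroup (f := fun l => gen l.swap) (rels := relators) (by
    rintro r (rfl | rfl)
    · simpa [Letter.swap] using mul_eq_one_iff_eq_inv.2 rel_y
    · simpa [Letter.swap] using mul_eq_one_iff_eq_inv.2 rel_x)

theorem swapHom_gen (l : Letter) : swapHom (gen l) = gen l.swap := PresentedGroup.toGroup.of _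

theorem swapHom_swapHom (g : Gam) : swapHom (swapHom g) = g := by
  have : swapHom.comp swapHom = MonoidHom.id Gam := by
    refine PresentedGroup.ext fun l => ?_
    change swapHom (swapHom (gen l)) = gen l
    rw [swapHom_gen, swapHom_gen]
    cases l <;> rfl
  exact DFunLike.congr_fun this g

theorem swapHom_nu (i j : ℤ) : swapHom (nu (Multiplicative.ofAdd (i, j))) =
    nu (Multiplicative.ofAdd (j, i)) := by
  rw [nu_apply, nu_apply, map_mul, map_zpow, map_zpow, map_pow, map_pow, swapHom_gen, swapHom_gen]
  exact (commute_sq.symm.zpow_zpow i j).eq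

variable (K : Type*) [Field K]

/-- The automorphism of `KΓ` that interchanges `x` and `y`. -/
noncomputable def swapAlg : MonoidAlgebra K Gam →+* MonoidAlgebra K Gam :=
  MonoidAlgebra.mapDomainRingHom K swapHom

variable {K}

theorem swapAlg_single (g : Gam) (c : K) :
    swapAlg K (MonoidAlgebra.single g c) = MonoidAlgebra.single (swapHom g) c :=
  MonoidAlgebra.mapDomain_single

theorem swapAlg_swapAlg (σ : MonoidAlgebra K Gam) : swapAlg K (swapAlg K σ) = σ := by
  induction σ using MonoidAlgebra.induction_linear with
  | zero => simp
  | add f g hf hg => rw [map_add, map_add, hf, hg]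
  | single g c => rw [swapAlg_single, swapAlg_single, swapHom_swapHom]

theorem IsTrivialUnit.swapAlg {σ : MonoidAlgebra K Gam} (h : IsTrivialUnit σ) :
    IsTrivialUnit (swapAlg K σ) := by
  obtain ⟨c, g, hc, rfl⟩ := h
  exact ⟨c, swapHom g, hc, swapAlg_single g c⟩

theorem exists_swapAlg_smul (p : Lau K) :
    ∃ q : Lau K, ∀ z, FoursGroup.swapAlg K (p • z) = q • FoursGroup.swapAlg K z := by
  suffices h : ∃ q : Lau K, FoursGroup.swapAlg K (iota K p) = iota K q by
    obtain ⟨q, hq⟩ := h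
    exact ⟨q, fun z => by rw [lau_smul_def, map_mul, hq, lau_smul_def]⟩
  induction p using AddMonoidAlgebra.induction_linear with
  | zero => exact ⟨0, by simp⟩
  | add f g hf hg =>
    obtain ⟨f', hf⟩ := hf
    obtain ⟨g', hg⟩ := hg
    exact ⟨f' + g', by rw [map_add, map_add, map_add, hf, hg]⟩
  | single m c =>
    exact ⟨AddMonoidAlgebra.single (m.2, m.1) c, by
      rw [iota_single, swapAlg_single, iota_single, swapHom_nu]⟩

theorem swapAlg_gX : FoursGroup.swapAlg K (gX K) = gY K := by
  rw [gX, MonoidAlgebra.of_apply, swapAlg_single, swapHom_gen]; rfl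

theorem swapAlg_gY : FoursGroup.swapAlg K (gY K) = gX K := by
  rw [gY, MonoidAlgebra.of_apply, swapAlg_single, swapHom_gen]; rfl

theorem exists_swapAlg_short (p₀ p₁ q₁ p₂ q₂ q₃ : Lau K) : ∃ r₀ r₁ s₁ r₂ s₂ r₃,
    FoursGroup.swapAlg K (short p₀ p₁ q₁ p₂ q₂ 0 q₃) = short r₀ r₁ s₁ r₂ s₂ r₃ 0 := by
  obtain ⟨p₀', h₀⟩ := exists_swapAlg_smul p₀
  obtain ⟨p₁', h₁⟩ := exists_swapAlg_smul p₁
  obtain ⟨q₁', k₁⟩ := exists_swapAlg_smul q₁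
  obtain ⟨p₂', h₂⟩ := exists_swapAlg_smul p₂
  obtain ⟨q₂', k₂⟩ := exists_swapAlg_smul q₂
  obtain ⟨q₃', k₃⟩ := exists_swapAlg_smul q₃
  refine ⟨p₀', q₁', p₁', q₂', p₂', q₃', ?_⟩
  simp only [short, map_add, h₀, h₁, k₁, h₂, k₂, k₃, map_mul, map_one, swapAlg_gX, swapAlg_gY,
    zero_smul, map_zero]
  module

/-- Every unit of length at most `3` is trivial. -/
theorem isTrivialUnit_of_length_le {σ : MonoidAlgebra K Gam} (hσ : IsUnit σ)
    (h : length σ ≤ 3) : IsTrivialUnit σ := by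
  obtain ⟨p₀, p₁, q₁, p₂, q₂, p₃, q₃, rfl⟩ := exists_short_of_length_le h
  have hreg : IsRightRegular (short p₀ p₁ q₁ p₂ q₂ p₃ q₃) := by
    obtain ⟨τ, hτ⟩ := hσ.exists_right_inv
    exact ⟨τ, 1, one_ne_zero, by rw [hτ, one_smul]⟩
  rcases hreg.leading_three with rfl | rfl
  · obtain ⟨r₀, r₁, s₁, r₂, s₂, r₃, hr⟩ := exists_swapAlg_short p₀ p₁ q₁ p₂ q₂ q₃
    have hu := hσ.map (FoursGroup.swapAlg K)
    rw [hr] at hu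
    have ht := isTrivialUnit_short hu
    rw [← hr] at ht
    rw [← swapAlg_swapAlg (short p₀ p₁ q₁ p₂ q₂ 0 q₃)]
    exact ht.swapAlg
  · exact isTrivialUnit_short hσ

end Swap

/-! ### The quotient by `N` as the infinite dihedral group. -/

section Dihedral

/-- The reflections of the infinite dihedral group that are assigned to the letters. -/
def dihedralLetter : Letter → DihedralGroup 0
  | Letter.x => DihedralGroup.sr 0
  | Letter.y => DihedralGroup.sr 1

theorem dihedralLetter_sq (l : Letter) : dihedralLetter l ^ 2 = 1 := by
  cases l <;> simp [dihedralLetter, pow_two]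

/-- The homomorphism from `Γ` onto the infinite dihedral group. -/
def toDihedral : Gam →* DihedralGroup 0 :=
  PresentedGroup.toGroup (f := dihedralLetter) (rels := relators) (by
    rintro r (rfl | rfl) <;> simp [dihedralLetter_sq])

theorem toDihedral_gen (l : Letter) : toDihedral (gen l) = dihedralLetter l :=
  PresentedGroup.toGroup.of _

/-- The action of the infinite dihedral group on the integer line that induces `act`. -/
def dihedralAct : DihedralGroup 0 →* Equiv.Perm ℤ where
  toFun
    | DihedralGroup.r i => Equiv.addLeft (2 * (show ℤ from i))
    -- The constant makes `sr 0` and `sr 1` act as `refl` does for `x` and `y`.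
    | DihedralGroup.sr i => Equiv.subLeft (1 - 2 * (show ℤ from i))
  map_one' := by
    ext v
    change 2 * (0 : ℤ) + v = v
    ring
  map_mul' g h := by
    ext v
    rcases g with i | i <;> rcases h with j | j <;> change ℤ at i j
    · change 2 * (i + j) + v = 2 * i + (2 * j + v)
      ring
    · change 1 - 2 * (j - i) - v = 2 * i + (1 - 2 * j - v)
      ring
    · change 1 - 2 * (i + j) - v = 1 - 2 * i - (2 * j + v)
      ring
    · change 2 * (j - i) + v = 1 - 2 * i - (1 - 2 * j - v)
      ring

theorem dihedralAct_toDihedral (g : Gam) : dihedralAct (toDihedral g) = act g := by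
  have : dihedralAct.comp toDihedral = act := by
    refine PresentedGroup.ext fun l => ?_
    change dihedralAct (toDihedral (gen l)) = act (gen l)
    rw [toDihedral_gen, act_gen]
    cases l
    · rfl
    · rfl
  exact DFunLike.congr_fun this g

/-- An element of the kernel acts trivially on `ℤ`, hence so does its alternating word, and only the
empty word fixes `0`. -/
theorem toDihedral_ker : toDihedral.ker = N := by
  refine le_antisymm (fun g hg => ?_) ((Subgroup.closure_le _).2 ?_)
  · obtain ⟨w, hw⟩ := exists_word g
    have h1 : act g = 1 := by rw [← dihedralAct_toDihedral, MonoidHom.mem_ker.1 hg, map_one]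
    have h2 := act_N hw
    rw [map_mul, map_inv, h1, one_mul, inv_eq_one] at h2
    have h3 : w.1 = [] := eval_injective _ _ w.2 List.isChain_nil (by rw [h2]; simp [eval])
    rw [h3] at hw
    simpa [eval] using hw
  · rintro g (rfl | rfl) <;> simp [MonoidHom.mem_ker, toDihedral_gen, dihedralLetter_sq]

theorem toDihedral_surjective : Function.Surjective toDihedral := by
  have hr : ∀ i : ℤ, toDihedral ((gen Letter.x * gen Letter.y) ^ i) = DihedralGroup.r i := by
    intro i
    rw [map_zpow, map_mul, toDihedral_gen, toDihedral_gen]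
    change (DihedralGroup.sr 0 * DihedralGroup.sr 1 : DihedralGroup 0) ^ i = _
    rw [DihedralGroup.sr_mul_sr, sub_zero, DihedralGroup.r_one_zpow]
    rfl
  rintro (i | i)
  · exact ⟨_, hr i⟩
  · refine ⟨gen Letter.x * (gen Letter.x * gen Letter.y) ^ (show ℤ from i), ?_⟩
    rw [map_mul, hr, toDihedral_gen]
    change DihedralGroup.sr 0 * DihedralGroup.r i = _
    rw [DihedralGroup.sr_mul_r, zero_add]

/-- The quotient `Γ/N` is infinite dihedral. -/
noncomputable def quotientEquiv : (Gam ⧸ N) ≃* DihedralGroup 0 :=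
  (QuotientGroup.quotientMulEquivOfEq toDihedral_ker.symm).trans
    (QuotientGroup.quotientKerEquivOfSurjective toDihedral toDihedral_surjective)

theorem quotientEquiv_mk (g : Gam) : quotientEquiv (g : Gam ⧸ N) = toDihedral g := rfl

end Dihedral

end FoursGroup

theorem theorem5p1 (K : Type*) [Field K] :
    (∃ e : (FoursGroup.Gam ⧸ FoursGroup.N) ≃* DihedralGroup 0,
      e (FoursGroup.gen FoursGroup.Letter.x : FoursGroup.Gam ⧸ FoursGroup.N) =
        DihedralGroup.sr 0 ∧
      e (FoursGroup.gen FoursGroup.Letter.y : FoursGroup.Gam ⧸ FoursGroup.N) =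
        DihedralGroup.sr 1) ∧
    (∀ σ : MonoidAlgebra K FoursGroup.Gam, IsUnit σ → FoursGroup.length σ = 3 →
      FoursGroup.IsTrivialUnit σ) ∧
    (∀ σ : MonoidAlgebra K FoursGroup.Gam, IsUnit σ → FoursGroup.length σ ≤ 3 →
      FoursGroup.IsTrivialUnit σ) := by
  refine ⟨⟨FoursGroup.quotientEquiv, ?_, ?_⟩, ?_, ?_⟩
  · rw [FoursGroup.quotientEquiv_mk, FoursGroup.toDihedral_gen]; rfl
  · rw [FoursGroup.quotientEquiv_mk, FoursGroup.toDihedral_gen]; rfl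
  · exact fun σ hσ h => FoursGroup.isTrivialUnit_of_length_le hσ h.le
  · exact fun σ hσ h => FoursGroup.isTrivialUnit_of_length_le hσ h
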